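/- An isomorphism class of finite abelian groups $G$ has as its group-partitions the sequences $(G_i)_{i\ge 1}$ of isomorphism classes of finite abelian groups such that $G \cong G_1\oplus G_2\oplus G_3\oplus\cdots$ and $G_1\supseteq G_2\supseteq G_3\supseteq\cdots$, where $G_i\supseteq G_{i+1}$ means that $G_{i+1}$ is isomorphic to a subgroup of $G_i$ (so all but finitely many $G_i$ are trivial). For $r\in\{1,2,3,\dots\}\cup\{\infty\}$ let $\pi_r(G)$ be the number of group-partitions of $G$ with at most $r$ factors, i.e. with $G_i$ trivial for all $i>r$ ($\pi_\infty(G)$ is the number of all group-partitions of $G$), and for $n\ge 1$ let $a_r(n)=\sum_{|G|=n}\pi_r(G)$, where $G$ runs over the isomorphism classes of abelian groups of order $n$. **Theorem 4.3.** Let $r\in\{1,2,3,\dots\}\cup\{\infty\}$. Then the product $\prod_{m\ge 2}\zeta(m)^{\min(m,r)}$ converges unconditionally, and $$\sum_{n\le x} a_r(n)=\Bigl(\prod_{m=2}^{\infty}\zeta(m)^{\min(m,r)}\Bigr)x+o(x)\qquad(x\to\infty).$$ More precisely, if $j$ and $k$ are positive integers with $(j,k)=1$, then the product over $m\ge 1$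 in $$c_r(j)=\prod_{m=1}^{\infty}\prod_{p\mid j}(1-p^{-m})^{\min(m,r)}\cdot\prod_{m=2}^{\infty}\zeta(m)^{\min(m,r)}$$ (where $p$ runs over the primes dividing $j$) converges unconditionally, $c_r(j)>0$, and $$\sum_{\substack{n\le x\\ n\equiv k\ (\mathrm{mod}\ j)}} a_r(n)=\frac{c_r(j)}{\varphi(j)}\,x+o(x)\qquad(x\to\infty),$$ where $\varphi$ is Euler's function. -/

import Mathlib

open Filter Asymptotics

noncomputable section

/-- A finite abelian group (written additively). -/
structure FinAb where
  carrier : Type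
  [group : AddCommGroup carrier]
  [finite : Finite carrier]

attribute [instance] FinAb.group FinAb.finite

/-- Two finite abelian groups are equivalent when they are isomorphic. -/
instance FinAb.isoSetoid : Setoid FinAb where
  r A B := Nonempty (A.carrier ≃+ B.carrier)
  iseqv := ⟨fun _ => ⟨AddEquiv.refl _⟩, fun ⟨e⟩ => ⟨e.symm⟩, fun ⟨e⟩ ⟨f⟩ => ⟨e.trans f⟩⟩

/-- Isomorphism classes of finite abelian groups. -/
def FinAbClass : Type 1 := Quotient FinAb.isoSetoid

namespace FinAbClass

/-- A group in the isomorphism class `G`. The notions below do not depend on the choice. -/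
abbrev Rep (G : FinAbClass) : Type := (Quotient.out G).carrier

/-- The order `|G|`. -/
def order (G : FinAbClass) : ℕ := Nat.card G.Rep

/-- `G ⊇ H`: a group in the class `H` is isomorphic to a subgroup of a group in the class `G`. -/
def Contains (G H : FinAbClass) : Prop := ∃ f : H.Rep →+ G.Rep, Function.Injective f

/-- `(P 0, P 1, P 2, …)` is a group-partition of `G`: `G = P 0 ⊕ P 1 ⊕ P 2 ⊕ ⋯` and
`P 0 ⊇ P 1 ⊇ P 2 ⊇ ⋯`. As `G` is finite, all but finitely many of the `P i` are trivial. -/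
def IsGroupPartition (P : ℕ → FinAbClass) (G : FinAbClass) : Prop :=
  Nonempty (G.Rep ≃+ DirectSum ℕ fun i => (P i).Rep) ∧ ∀ i, (P i).Contains (P (i + 1))

/-- `P` has at most `r` factors: all terms after the first `r` are trivial (no condition when
`r = ⊤`). -/
def AtMostFactors (P : ℕ → FinAbClass) (r : ℕ∞) : Prop :=
  ∀ i : ℕ, r ≤ (i : ℕ∞) → Subsingleton (P i).Rep

/-- `π_r(G)`: the number of group-partitions of `G` with at most `r` factors; `r = ⊤` counts all
group-partitions. -/
def numPartitions (r : ℕ∞) (G : FinAbClass) : ℕ :=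
  {P : ℕ → FinAbClass | IsGroupPartition P G ∧ AtMostFactors P r}.ncard

end FinAbClass

/-- `a_r(n) = ∑_{|G| = n} π_r(G)`, where `G` runs over the (finitely many) isomorphism classes of
abelian groups of order `n`. -/
def groupPartitionCount (r : ℕ∞) (n : ℕ) : ℕ :=
  ∑ᶠ (G : FinAbClass) (_ : G.order = n), G.numPartitions r

/-- `min(m, r)` as a natural number, where `r` may be infinite. -/
def minExp (m : ℕ) (r : ℕ∞) : ℕ := (min (m : ℕ∞) r).toNat

/-- `ζ(m) ^ min(m, r)`, for `m ≥ 2`, where `ζ(m)` is a real number. -/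
def zetaFactor (r : ℕ∞) (m : ℕ) : ℝ := (riemannZeta (m : ℂ)).re ^ minExp m r

/-- `∏_{p ∣ j} (1 - p ^ (-m)) ^ min(m, r)`, the product being over the primes dividing `j`. -/
def localFactor (r : ℕ∞) (j m : ℕ) : ℝ :=
  ∏ p ∈ j.primeFactors, (1 - ((p : ℝ) ^ m)⁻¹) ^ minExp m r

/-- `c_r(j) = ∏_{m ≥ 1} ∏_{p ∣ j} (1 - p ^ (-m)) ^ min(m, r) · ∏_{m ≥ 2} ζ(m) ^ min(m, r)`. -/
def cConst (r : ℕ∞) (j : ℕ) : ℝ :=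
  (∏' i : ℕ, localFactor r j (i + 1)) * ∏' i : ℕ, zetaFactor r (i + 2)

end

/-! Fix a prime `p` and let `π (a, i)` be the number of cyclic summands of `G_i` whose order is
divisible by `p ^ (a + 1)`. One finite abelian group embeds in another exactly when none of these
ranks is larger, so a group-partition of a group of order `n` is the same thing as a choice, for
every `p`, of a plane partition of `v_p(n)` with at most `r` rows (`planePartitionAt_bijective`). By
MacMahon's theorem (`planePartitions_equiv_weightedArrays`) plane partitions with at most `r` rows
have the generating function `∏ (1 - q ^ m)⁻¹ ^ min(m, r)`. It is proved here by cutting along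
diagonals into interlacing sequences and specialising the Cauchy identity for Schur functions, which
itself follows from a commutation relation of two transfer operators (`downOp_upOp`).

Multiplying over all primes, the Dirichlet series of `a_r` is `∏_{m ≥ 1} ζ(ms) ^ min(m, r)`. In
combinatorial form, `a_r(n)` counts arrays of positive integers on the cells `(i, l)` with `l < r`
whose product, with exponents `i + l + 1`, is `n`; the exponent `m` occurs at `min(m, r)` cells. The
exponent `1` belongs to the origin alone, and splitting off that cell gives `a_r = 1 * b` with `b =
reducedCount r ≥ 0` (`groupPartitionCount_eq_sum_divisors`) and `∑ b(d) / d = ∏_{m ≥ 2} ζ(m) ^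
min(m, r)`. This is finite because `ζ(m) - 1 = O(2 ^ (-m))`.

No Tauberian theorem is needed. The sum over `n ≡ k` is `∑ b(d) #{m ≤ x / d : d m ≡ k}`. For `d` not
prime to `j` the count is zero; otherwise it is `x / (d j) + O(1)` and at most `x / d`. After
division by `x`, dominated convergence gives the limit `(1 / j) ∑_{(d, j) = 1} b(d) / d`. This
equals `c_r(j) / φ(j)`, since the factor of `c_r(j)` at `m = 1` is `φ(j) / j`. -/

open scoped ENNReal

/-! ### Infinite distributivity in `ℝ≥0∞` -/

/-- Finite distributivity for products of infinite series of extended nonnegative reals. -/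
theorem tsum_finsupp_prod_of_support_subset {ι : Type*} (F : ι → ℕ → ℝ≥0∞)
    (hF : ∀ c, F c 0 = 1) (s : Finset ι) :
    ∑' g : {g : ι →₀ ℕ // g.support ⊆ s}, g.1.prod F = ∏ c ∈ s, ∑' k, F c k := by
  classical
  induction s using Finset.induction_on with
  | empty =>
    rw [tsum_eq_single (⟨0, by simp⟩ : {g : ι →₀ ℕ // g.support ⊆ (∅ : Finset ι)})
      (fun b hb => (hb (Subtype.ext (by simpa using b.2))).elim)]
    exact (Finsupp.prod_zero_index (h := F)).trans Finset.prod_empty.symm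
  | insert a s ha ih =>
    let e : {g : ι →₀ ℕ // g.support ⊆ insert a s} ≃ ℕ × {g : ι →₀ ℕ // g.support ⊆ s} :=
      { toFun := fun g => (g.1 a, ⟨g.1.erase a, by
          rw [Finsupp.support_erase]
          intro x hx
          have h1 := Finset.mem_erase.1 hx
          exact (Finset.mem_insert.1 (g.2 h1.2)).resolve_left h1.1⟩)
        invFun := fun x => ⟨x.2.1.update a x.1, by
          intro c hc
          by_cases h : c = a
          · simp [h]
          · rw [Finsupp.mem_support_iff, Finsupp.update_apply, if_neg h] at hc
            exact Finset.mem_insert_of_mem (x.2.2 (Finsupp.mem_support_iff.2 hc))⟩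
        left_inv := fun g => by
          ext c
          by_cases h : c = a <;> simp [h]
        right_inv := fun x => by
          have hx : x.2.1 a = 0 := by
            by_contra h
            exact ha (x.2.2 (Finsupp.mem_support_iff.2 h))
          refine Prod.ext (by simp) (Subtype.ext ?_)
          ext c
          by_cases h : c = a
          · subst h; simp [hx]
          · simp [h] }
    rw [Finset.prod_insert ha, ← ih, ← ENNReal.tsum_mul_right]
    simp_rw [← ENNReal.tsum_mul_left]
    rw [← ENNReal.tsum_prod, ← e.tsum_eq]
    refine tsum_congr fun g => ?_
    change _ = F a (g.1 a) * (g.1.erase a).prod F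
    rw [Finsupp.mul_prod_erase' g.1 a F fun i => hF i]

/-- Infinite distributivity for products of infinite series of extended nonnegative reals. -/
theorem tsum_finsupp_prod {ι : Type*} (F : ι → ℕ → ℝ≥0∞) (hF : ∀ c, F c 0 = 1) :
    ∑' g : ι →₀ ℕ, g.prod F = ⨆ s : Finset ι, ∏ c ∈ s, ∑' k, F c k := by
  classical
  apply le_antisymm
  · rw [ENNReal.tsum_eq_iSup_sum]
    -- Finitely many `g` have all their supports inside one finite set, which reduces the bound to
    -- finite distributivity.
    refine iSup_le fun t => le_iSup_of_le (t.biUnion fun g => g.support) ?_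
    rw [← tsum_finsupp_prod_of_support_subset F hF, ← Finset.tsum_subtype]
    refine ENNReal.tsum_comp_le_tsum_of_injective
      (f := fun g : {g // g ∈ t} => (⟨g.1, Finset.subset_biUnion_of_mem
        (fun g : ι →₀ ℕ => g.support) g.2⟩ :
        {g : ι →₀ ℕ // g.support ⊆ t.biUnion fun g => g.support})) ?_ (fun g => g.1.prod F)
    intro g h hgh
    exact Subtype.ext (congrArg (fun x => x.1) hgh)
  · refine iSup_le fun s => ?_
    rw [← tsum_finsupp_prod_of_support_subset F hF]
    exact ENNReal.tsum_comp_le_tsum_of_injective Subtype.val_injective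
      fun g : ι →₀ ℕ => g.prod F

/-! ### Generating functions determine cardinalities -/

/-- A power series with real coefficients which vanishes on `[0, 1)` has vanishing coefficients. -/
theorem eq_zero_of_hasSum_mul_pow_eq_zero (c : ℕ → ℝ)
    (h : ∀ q : ℝ, 0 ≤ q → q < 1 → HasSum (fun n => c n * q ^ n) 0) (n : ℕ) : c n = 0 := by
  induction n using Nat.strong_induction_on with
  | _ n ih =>
    have hs : ∀ q : ℝ, 0 < q → q < 1 → HasSum (fun k => c (k + n) * q ^ k) 0 := by
      intro q h0 h1
      have h2 := (hasSum_nat_add_iff' n).2 (h q h0.le h1)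
      rw [Finset.sum_eq_zero (fun i hi => by rw [ih i (Finset.mem_range.1 hi), zero_mul])] at h2
      have h3 := h2.mul_left ((q ^ n)⁻¹)
      rw [sub_zero, mul_zero] at h3
      have h4 : (fun k => (q ^ n)⁻¹ * (c (k + n) * q ^ (k + n))) = fun k => c (k + n) * q ^ k := by
        funext k
        rw [pow_add]
        field_simp
      rwa [h4] at h3
    have h2 := (hs (1 / 2) (by norm_num) (by norm_num)).summable
    have h3 : Summable fun k => |c (k + 1 + n)| * (1 / 2 : ℝ) ^ k := by
      have h4 := ((summable_nat_add_iff 1).2 h2).abs.mul_left 2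
      refine h4.congr fun k => ?_
      rw [abs_mul, abs_pow, abs_of_pos (by norm_num : (0 : ℝ) < 1 / 2), pow_succ]
      ring
    -- The lower coefficients vanish, so after division by `q ^ n` the term `c n` equals minus a
    -- tail divisible by `q`; the tail is bounded by its absolute value at `1 / 2`.
    have key : ∀ q : ℝ, 0 < q → q < 1 / 2 →
        |c n| ≤ q * ∑' k, |c (k + 1 + n)| * (1 / 2 : ℝ) ^ k := by
      intro q h0 h1
      have h4 := (hasSum_nat_add_iff' 1).2 (hs q h0 (by linarith))
      simp only [Finset.range_one, Finset.sum_singleton, pow_zero, mul_one, zero_add,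
        zero_sub] at h4
      rw [← abs_neg, ← tsum_mul_left, ← Real.norm_eq_abs]
      refine h4.norm_le_of_bounded (h3.mul_left q).hasSum fun k => ?_
      rw [Real.norm_eq_abs, abs_mul, abs_pow, abs_of_pos h0, pow_succ]
      have : q ^ k ≤ (1 / 2 : ℝ) ^ k := pow_le_pow_left₀ h0.le h1.le k
      nlinarith [mul_le_mul_of_nonneg_left this (mul_nonneg h0.le (abs_nonneg (c (k + 1 + n))))]
    have lim : Tendsto (fun q : ℝ => q * ∑' k, |c (k + 1 + n)| * (1 / 2 : ℝ) ^ k)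
        (nhdsWithin 0 (Set.Ioi 0)) (nhds 0) := by
      have : Tendsto (fun q : ℝ => q * ∑' k, |c (k + 1 + n)| * (1 / 2 : ℝ) ^ k)
          (nhds 0) (nhds (0 * ∑' k, |c (k + 1 + n)| * (1 / 2 : ℝ) ^ k)) :=
        tendsto_id.mul_const _
      rw [zero_mul] at this
      exact this.mono_left nhdsWithin_le_nhds
    have := ge_of_tendsto lim (b := |c n|) (by
      filter_upwards [Ioo_mem_nhdsGT (by norm_num : (0 : ℝ) < 1 / 2)] with q hq
      exact key q hq.1 hq.2)
    exact abs_eq_zero.1 (le_antisymm this (abs_nonneg _))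

open scoped NNReal in
/-- The fibres of a weight function with summable generating function are finite. -/
theorem finite_fiber_of_tsum_pow_ne_top {S : Type*} (u : S → ℕ) {q : ℝ≥0} (hq : q ≠ 0)
    (h : ∑' s, (q : ℝ≥0∞) ^ u s ≠ ⊤) (n : ℕ) : Finite {s // u s = n} := by
  have h1 := ENNReal.finite_const_le_of_tsum_ne_top h (ε := (q : ℝ≥0∞) ^ n)
    (pow_ne_zero n (by simpa using hq))
  exact (h1.subset fun s (hs : u s = n) => by simp [hs]).to_subtype

open scoped NNReal in
theorem tsum_pow_eq_tsum_card_fiber {S : Type*} (u : S → ℕ) [∀ n, Finite {s // u s = n}]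
    (q : ℝ≥0∞) : ∑' s, q ^ u s = ∑' n, (Nat.card {s // u s = n} : ℝ≥0∞) * q ^ n := by
  rw [← (Equiv.sigmaFiberEquiv u).tsum_eq, ENNReal.tsum_sigma']
  refine tsum_congr fun n => ?_
  have := Fintype.ofFinite {s // u s = n}
  rw [tsum_fintype, Finset.sum_congr rfl (fun s _ => by
    rw [show (Equiv.sigmaFiberEquiv u ⟨n, s⟩) = s.1 from rfl, s.2])]
  simp

open scoped NNReal in
/-- Two weighted sets with equal, convergent generating functions have equinumerous fibres. -/
theorem nonempty_equiv_fiber_of_tsum_pow_eq {S T : Type*} (u : S → ℕ) (v : T → ℕ)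
    (h : ∀ q : ℝ≥0, q < 1 → ∑' s, (q : ℝ≥0∞) ^ u s = ∑' t, (q : ℝ≥0∞) ^ v t)
    (hv : ∀ q : ℝ≥0, q < 1 → ∑' t, (q : ℝ≥0∞) ^ v t ≠ ⊤) (n : ℕ) :
    Nonempty ({s // u s = n} ≃ {t // v t = n}) ∧ Finite {s // u s = n} := by
  have h2 : (1 / 2 : ℝ≥0) < 1 := by
    rw [← NNReal.coe_lt_coe]; norm_num
  have hT : ∀ n, Finite {t // v t = n} :=
    finite_fiber_of_tsum_pow_ne_top v (q := 1 / 2) (by norm_num) (hv _ h2)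
  have hS : ∀ n, Finite {s // u s = n} :=
    finite_fiber_of_tsum_pow_ne_top u (q := 1 / 2) (by norm_num) (by rw [h _ h2]; exact hv _ h2)
  refine ⟨?_, hS n⟩
  rw [← Finite.card_eq]
  -- Subtraction requires real numbers; finiteness of both sums for `q < 1` permits leaving `ℝ≥0∞`.
  have key : ∀ m, (Nat.card {s // u s = m} : ℝ) - (Nat.card {t // v t = m} : ℝ) = 0 := by
    refine eq_zero_of_hasSum_mul_pow_eq_zero _ fun q h0 h1 => ?_
    lift q to ℝ≥0 using h0
    have h1 : q < 1 := by exact_mod_cast h1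
    have e1 := tsum_pow_eq_tsum_card_fiber u (q : ℝ≥0∞)
    have e2 := tsum_pow_eq_tsum_card_fiber v (q : ℝ≥0∞)
    have f2 := hv q h1
    have f1 := f2
    rw [← h q h1] at f1
    have f3 := h q h1
    rw [e1] at f1
    rw [e2] at f2
    rw [e1, e2] at f3
    have g1 := ENNReal.hasSum_toReal f1
    have g2 := ENNReal.hasSum_toReal f2
    rw [← ENNReal.tsum_toReal_eq (fun a => ENNReal.ne_top_of_tsum_ne_top f1 a), f3] at g1
    rw [← ENNReal.tsum_toReal_eq (fun a => ENNReal.ne_top_of_tsum_ne_top f2 a)] at g2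
    simpa [sub_mul] using g1.sub g2
  exact_mod_cast sub_eq_zero.1 (key n)

/-! ### Interlacing sequences and the Cauchy identity -/

/-- The sequences `μ`, `l` interlace: `l 0 ≥ μ 0 ≥ l 1 ≥ μ 1 ≥ ⋯`. -/
def Interlace (μ l : ℕ →₀ ℕ) : Prop := ∀ k, μ k ≤ l k ∧ l (k + 1) ≤ μ k

theorem Finsupp.exists_forall_ge_eq_zero (f : ℕ →₀ ℕ) : ∃ B, ∀ k, B ≤ k → f k = 0 := by
  refine ⟨f.support.sup id + 1, fun k hk => ?_⟩
  by_contra h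
  have : k ≤ f.support.sup id := Finset.le_sup (f := id) (Finsupp.mem_support_iff.2 h)
  omega

theorem Finsupp.degree_eq_sum_range (f : ℕ →₀ ℕ) {B : ℕ} (h : ∀ k, B ≤ k → f k = 0) :
    f.degree = ∑ k ∈ Finset.range B, f k := by
  rw [Finsupp.degree_apply]
  refine Finset.sum_subset (fun k hk => ?_) fun k _ hk => by simpa using hk
  by_contra h'
  exact Finsupp.mem_support_iff.1 hk (h k (by simpa using h'))

theorem finite_support_of_forall_ge_eq_zero {f : ℕ → ℕ} {B : ℕ} (h : ∀ k, B ≤ k → f k = 0) :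
    (Function.support f).Finite := by
  refine (Finset.range B).finite_toSet.subset fun k hk => ?_
  by_contra h'
  exact hk (h k (by simpa using h'))

theorem Interlace.le {μ l : ℕ →₀ ℕ} (h : Interlace μ l) : μ ≤ l := fun k => (h k).1

theorem Interlace.eq_zero {μ : ℕ →₀ ℕ} (h : Interlace μ 0) : μ = 0 := le_antisymm h.le zero_le

theorem interlace_zero_zero : Interlace 0 0 := fun _ => ⟨le_rfl, le_rfl⟩

theorem Interlace.degree_le {μ l : ℕ →₀ ℕ} (h : Interlace μ l) : μ.degree ≤ l.degree :=
  Finsupp.degree_mono h.le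

theorem exists_bound_pair (μ ν : ℕ →₀ ℕ) : ∃ B, ∀ k, B ≤ k → μ k = 0 ∧ ν k = 0 := by
  obtain ⟨B, hB⟩ := μ.exists_forall_ge_eq_zero
  obtain ⟨C, hC⟩ := ν.exists_forall_ge_eq_zero
  exact ⟨max B C, fun k hk => ⟨hB k (le_trans (le_max_left _ _) hk),
    hC k (le_trans (le_max_right _ _) hk)⟩⟩

/-- The sequence `k ↦ max (μ (k+1)) (ν (k+1)) + min (μ k) (ν k) - l (k+1)`. -/
noncomputable def reflectDown (μ ν l : ℕ →₀ ℕ) : ℕ →₀ ℕ :=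
  Finsupp.ofSupportFinite (fun k => max (μ (k + 1)) (ν (k + 1)) + min (μ k) (ν k) - l (k + 1)) <| by
    obtain ⟨B, hB⟩ := exists_bound_pair μ ν
    refine finite_support_of_forall_ge_eq_zero (B := B) fun k hk => ?_
    simp [hB k hk, hB (k + 1) (by omega)]

/-- The sequence starting with `max (μ 0) (ν 0) + m` whose `(k+1)`-st term is
`max (μ (k+1)) (ν (k+1)) + min (μ k) (ν k) - κ k`. -/
noncomputable def reflectUp (μ ν : ℕ →₀ ℕ) (m : ℕ) (κ : ℕ →₀ ℕ) : ℕ →₀ ℕ :=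
  Finsupp.ofSupportFinite (fun k => Nat.casesOn k (max (μ 0) (ν 0) + m)
    fun k => max (μ (k + 1)) (ν (k + 1)) + min (μ k) (ν k) - κ k) <| by
    obtain ⟨B, hB⟩ := exists_bound_pair μ ν
    refine finite_support_of_forall_ge_eq_zero (B := B + 1) fun k hk => ?_
    obtain ⟨k, rfl⟩ := Nat.exists_eq_succ_of_ne_zero (show k ≠ 0 by omega)
    simp [hB k (by omega), hB (k + 1) (by omega)]

theorem reflectDown_apply (μ ν l : ℕ →₀ ℕ) (k : ℕ) :
    reflectDown μ ν l k = max (μ (k + 1)) (ν (k + 1)) + min (μ k) (ν k) - l (k + 1) := rfl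

theorem reflectUp_zero (μ ν : ℕ →₀ ℕ) (m : ℕ) (κ : ℕ →₀ ℕ) :
    reflectUp μ ν m κ 0 = max (μ 0) (ν 0) + m := rfl

theorem reflectUp_succ (μ ν : ℕ →₀ ℕ) (m : ℕ) (κ : ℕ →₀ ℕ) (k : ℕ) :
    reflectUp μ ν m κ (k + 1) = max (μ (k + 1)) (ν (k + 1)) + min (μ k) (ν k) - κ k := rfl

/-- The local rule: common upper neighbours of `μ` and `ν` correspond to common lower neighbours
together with a natural number. -/
noncomputable def interlaceEquiv (μ ν : ℕ →₀ ℕ) :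
    {l // Interlace μ l ∧ Interlace ν l} ≃ ℕ × {κ // Interlace κ μ ∧ Interlace κ ν} where
  -- Both `l (k + 1)` and `κ k` range over the interval from `max (μ (k+1)) (ν (k+1))` to `min (μ k)
  -- (ν k)`, which is reflected onto itself. Only `l 0` is unbounded above; its excess over the
  -- maximum is the natural number.
  toFun l := (l.1 0 - max (μ 0) (ν 0), ⟨reflectDown μ ν l.1, by
    obtain ⟨l, h1, h2⟩ := l
    constructor <;> intro k <;> have a := h1 k <;> have b := h2 k <;>
      have c := h1 (k + 1) <;> have d := h2 (k + 1) <;> rw [reflectDown_apply] <;>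
      dsimp only <;> omega⟩)
  invFun x := ⟨reflectUp μ ν x.1 x.2.1, by
    obtain ⟨m, κ, h1, h2⟩ := x
    constructor <;> intro k <;> rw [reflectUp_succ] <;> cases k with
    | zero => have a := h1 0; have b := h2 0; rw [reflectUp_zero]; dsimp only at *; omega
    | succ k =>
      have a := h1 k; have b := h2 k; have c := h1 (k + 1); have d := h2 (k + 1)
      rw [reflectUp_succ]; dsimp only at *; omega⟩
  left_inv l := by
    obtain ⟨l, h1, h2⟩ := l
    ext k
    cases k with
    | zero => have a := h1 0; have b := h2 0; simp only [reflectUp_zero]; omega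
    | succ k =>
      have a := h1 k; have b := h2 k; have c := h1 (k + 1); have d := h2 (k + 1)
      simp only [reflectUp_succ, reflectDown_apply]; omega
  right_inv x := by
    obtain ⟨m, κ, h1, h2⟩ := x
    refine Prod.ext (by simp [reflectUp_zero]) (Subtype.ext (Finsupp.ext fun k => ?_))
    have a := h1 k; have b := h2 k
    simp only [reflectUp_succ, reflectDown_apply]; omega

/-- The reflection fixes `l (k + 1) + κ k = max (μ (k+1)) (ν (k+1)) + min (μ k) (ν k)`. Summing over
`k` and using `max + min = μ + ν` at each index gives the total. -/
theorem degree_interlaceEquiv_symm (μ ν : ℕ →₀ ℕ) (m : ℕ)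
    (κ : {κ // Interlace κ μ ∧ Interlace κ ν}) :
    ((interlaceEquiv μ ν).symm (m, κ)).1.degree + κ.1.degree = μ.degree + ν.degree + m := by
  obtain ⟨κ, h1, h2⟩ := κ
  change (reflectUp μ ν m κ).degree + κ.degree = _
  obtain ⟨B, hB⟩ := exists_bound_pair μ ν
  have hκ : ∀ k, B ≤ k → κ k = 0 := fun k hk => by
    have := (h1 k).1
    rw [(hB k hk).1] at this
    omega
  have hl : ∀ k, B + 1 ≤ k → reflectUp μ ν m κ k = 0 := fun k hk => by
    obtain ⟨k, rfl⟩ := Nat.exists_eq_succ_of_ne_zero (show k ≠ 0 by omega)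
    simp [reflectUp_succ, hB k (by omega), hB (k + 1) (by omega)]
  rw [Finsupp.degree_eq_sum_range _ hl, Finsupp.degree_eq_sum_range κ hκ,
    Finsupp.degree_eq_sum_range μ (B := B + 1) (fun k hk => (hB k (by omega)).1),
    Finsupp.degree_eq_sum_range ν (B := B) (fun k hk => (hB k hk).2), Finset.sum_range_succ',
    reflectUp_zero]
  have e1 : ∑ k ∈ Finset.range B, reflectUp μ ν m κ (k + 1) + ∑ k ∈ Finset.range B, κ k =
      ∑ k ∈ Finset.range B, max (μ (k + 1)) (ν (k + 1)) +
        ∑ k ∈ Finset.range B, min (μ k) (ν k) := by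
    rw [← Finset.sum_add_distrib, ← Finset.sum_add_distrib]
    refine Finset.sum_congr rfl fun k _ => ?_
    have a := h1 k; have b := h2 k
    rw [reflectUp_succ]; omega
  have e2 : ∑ k ∈ Finset.range B, max (μ (k + 1)) (ν (k + 1)) + max (μ 0) (ν 0) =
      ∑ k ∈ Finset.range B, max (μ k) (ν k) := by
    rw [← Finset.sum_range_succ' (fun k => max (μ k) (ν k)), Finset.sum_range_succ]
    simp [hB B le_rfl]
  have e3 : ∑ k ∈ Finset.range B, max (μ k) (ν k) + ∑ k ∈ Finset.range B, min (μ k) (ν k) =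
      ∑ k ∈ Finset.range B, μ k + ∑ k ∈ Finset.range B, ν k := by
    rw [← Finset.sum_add_distrib, ← Finset.sum_add_distrib]
    exact Finset.sum_congr rfl fun k _ => max_add_min _ _
  rw [Finset.sum_range_succ, (hB B le_rfl).1]
  omega

open scoped Classical in
/-- The transfer kernel of the interlacing relation. -/
noncomputable def interlaceKernel (x : ℝ≥0∞) (μ l : ℕ →₀ ℕ) : ℝ≥0∞ :=
  if Interlace μ l then x ^ (l.degree - μ.degree) else 0

/-- Under `interlaceEquiv` an upper neighbour becomes a lower neighbour and a number `m`; by the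
degree formula `m` contributes `(x * y) ^ m`, and the geometric series supplies the prefactor. -/
theorem tsum_interlaceKernel_mul (x y : ℝ≥0∞) (μ ν : ℕ →₀ ℕ) :
    ∑' l, interlaceKernel y μ l * interlaceKernel x ν l =
      (1 - x * y)⁻¹ * ∑' κ, interlaceKernel x κ μ * interlaceKernel y κ ν := by
  classical
  have e1 : ∑' l, interlaceKernel y μ l * interlaceKernel x ν l =
      ∑' l : {l // Interlace μ l ∧ Interlace ν l},
        y ^ (l.1.degree - μ.degree) * x ^ (l.1.degree - ν.degree) := by
    refine Eq.trans (tsum_congr fun l => ?_) (tsum_subtype {l | Interlace μ l ∧ Interlace ν l}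
      (fun l => y ^ (l.degree - μ.degree) * x ^ (l.degree - ν.degree))).symm
    by_cases h1 : Interlace μ l <;> by_cases h2 : Interlace ν l <;>
      simp [interlaceKernel, h1, h2]
  have e2 : ∑' κ, interlaceKernel x κ μ * interlaceKernel y κ ν =
      ∑' κ : {κ // Interlace κ μ ∧ Interlace κ ν},
        x ^ (μ.degree - κ.1.degree) * y ^ (ν.degree - κ.1.degree) := by
    refine Eq.trans (tsum_congr fun l => ?_) (tsum_subtype {κ | Interlace κ μ ∧ Interlace κ ν}
      (fun κ => x ^ (μ.degree - κ.degree) * y ^ (ν.degree - κ.degree))).symm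
    by_cases h1 : Interlace l μ <;> by_cases h2 : Interlace l ν <;>
      simp [interlaceKernel, h1, h2]
  rw [e1, e2, ← (interlaceEquiv μ ν).symm.tsum_eq, ENNReal.tsum_prod', ← ENNReal.tsum_geometric,
    ← ENNReal.tsum_mul_right]
  refine tsum_congr fun m => ?_
  rw [← ENNReal.tsum_mul_left]
  refine tsum_congr fun κ => ?_
  have h := degree_interlaceEquiv_symm μ ν m κ
  have h1 := κ.2.1.degree_le
  have h2 := κ.2.2.degree_le
  rw [show ((interlaceEquiv μ ν).symm (m, κ)).1.degree - μ.degree =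
      m + (ν.degree - κ.1.degree) by omega,
    show ((interlaceEquiv μ ν).symm (m, κ)).1.degree - ν.degree =
      m + (μ.degree - κ.1.degree) by omega, pow_add, pow_add, mul_pow]
  ring

/-- The operator adding a diagonal. -/
noncomputable def upOp (x : ℝ≥0∞) (f : (ℕ →₀ ℕ) → ℝ≥0∞) (l : ℕ →₀ ℕ) : ℝ≥0∞ :=
  ∑' μ, interlaceKernel x μ l * f μ

/-- The adjoint of `upOp`. -/
noncomputable def downOp (y : ℝ≥0∞) (f : (ℕ →₀ ℕ) → ℝ≥0∞) (μ : ℕ →₀ ℕ) : ℝ≥0∞ :=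
  ∑' l, interlaceKernel y μ l * f l

theorem downOp_upOp (x y : ℝ≥0∞) (f : (ℕ →₀ ℕ) → ℝ≥0∞) :
    downOp y (upOp x f) = fun μ => (1 - x * y)⁻¹ * upOp x (downOp y f) μ := by
  funext μ
  simp only [downOp, upOp, ← ENNReal.tsum_mul_left]
  rw [ENNReal.tsum_comm]
  conv_rhs => rw [ENNReal.tsum_comm]
  refine tsum_congr fun ν => ?_
  have := tsum_interlaceKernel_mul x y μ ν
  simp only [← mul_assoc]
  rw [ENNReal.tsum_mul_right, this, ENNReal.tsum_mul_right, ← ENNReal.tsum_mul_left]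
  simp only [← mul_assoc]

theorem tsum_upOp_mul (y : ℝ≥0∞) (f g : (ℕ →₀ ℕ) → ℝ≥0∞) :
    ∑' l, upOp y g l * f l = ∑' l, g l * downOp y f l := by
  simp only [downOp, upOp, ← ENNReal.tsum_mul_left, ← ENNReal.tsum_mul_right]
  rw [ENNReal.tsum_comm]
  exact tsum_congr fun ν => tsum_congr fun l => by ring

open scoped Classical in
/-- The indicator function of the empty partition. -/
noncomputable def emptyInd (l : ℕ →₀ ℕ) : ℝ≥0∞ := if l = 0 then 1 else 0

theorem downOp_emptyInd (y : ℝ≥0∞) : downOp y emptyInd = emptyInd := by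
  funext μ
  rw [downOp, tsum_eq_single 0 (fun l hl => by simp [emptyInd, hl])]
  by_cases h : μ = 0
  · simp [interlaceKernel, h, interlace_zero_zero, emptyInd]
  · have : ¬ Interlace μ 0 := fun h' => h h'.eq_zero
    simp [interlaceKernel, this, emptyInd, h]

/-- The Schur function `s_l(xs)` as a sum over interlacing sequences. -/
noncomputable def upList (xs : List ℝ≥0∞) : (ℕ →₀ ℕ) → ℝ≥0∞ := xs.foldr upOp emptyInd

/-- `downOp y` is moved past each `upOp x` at the cost of a factor `(1 - x * y)⁻¹`, until it reaches
`emptyInd`, which it fixes. -/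
theorem downOp_upList (y : ℝ≥0∞) (xs : List ℝ≥0∞) :
    downOp y (upList xs) = fun l => (xs.map fun x => (1 - x * y)⁻¹).prod * upList xs l := by
  induction xs with
  | nil => simp [upList, downOp_emptyInd]
  | cons x xs ih =>
    change downOp y (upOp x (upList xs)) = _
    rw [downOp_upOp, ih]
    funext l
    rw [List.map_cons, List.prod_cons, mul_assoc]
    change _ * upOp x _ l = _ * (_ * upOp x (upList xs) l)
    simp only [upOp, ← ENNReal.tsum_mul_left]
    exact tsum_congr fun μ => by ring

/-- The Cauchy identity. -/
theorem tsum_upList_mul_upList (xs ys : List ℝ≥0∞) :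
    ∑' l, upList ys l * upList xs l =
      (ys.map fun y => (xs.map fun x => (1 - x * y)⁻¹).prod).prod := by
  induction ys with
  | nil =>
    change ∑' l, emptyInd l * upList xs l = _
    rw [tsum_eq_single 0 (fun l hl => by simp [emptyInd, hl])]
    have : ∀ xs : List ℝ≥0∞, upList xs 0 = 1 := by
      intro xs
      induction xs with
      | nil => simp [upList, emptyInd]
      | cons x xs ih =>
        change upOp x (upList xs) 0 = 1
        rw [upOp, tsum_eq_single 0]
        · simp [interlaceKernel, interlace_zero_zero, ih]
        · intro l hl
          have : ¬ Interlace l 0 := fun h' => hl h'.eq_zero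
          simp [interlaceKernel, this]
    simp [this, emptyInd]
  | cons y ys ih =>
    change ∑' l, upOp y (upList ys) l * upList xs l = _
    -- Adjointness turns the outermost `upOp y` into a `downOp y` acting on the other Schur
    -- function.
    rw [tsum_upOp_mul, downOp_upList]
    simp only [List.map_cons, List.prod_cons, ← ih, ← ENNReal.tsum_mul_left]
    exact tsum_congr fun l => by ring

/-! ### Diagonals of plane partitions and MacMahon's theorem -/

/-- Sequences of interlacing partitions starting with `l` and vanishing from the `N`-th on. -/
def InterlacingChain (N : ℕ) (l : ℕ →₀ ℕ) : Type :=
  {c : ℕ → ℕ →₀ ℕ // c 0 = l ∧ (∀ d, Interlace (c (d + 1)) (c d)) ∧ c N = 0}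

theorem InterlacingChain.eq_zero {N : ℕ} {l : ℕ →₀ ℕ} (c : InterlacingChain N l) {d : ℕ}
    (h : N ≤ d) : c.1 d = 0 := by
  induction d, h using Nat.le_induction with
  | base => exact c.2.2.2
  | succ d _ ih => exact (ih ▸ c.2.2.1 d).eq_zero

/-- The generating function of interlacing chains. -/
noncomputable def chainSum (q : ℝ≥0∞) (N : ℕ) (l : ℕ →₀ ℕ) : ℝ≥0∞ :=
  ∑' c : InterlacingChain N l, q ^ ∑ d ∈ Finset.range N, (c.1 (d + 1)).degree

theorem chainSum_zero (q : ℝ≥0∞) (l : ℕ →₀ ℕ) : chainSum q 0 l = emptyInd l := by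
  by_cases h : l = 0
  · subst h
    let c : InterlacingChain 0 0 := ⟨fun _ => 0, rfl, fun _ => interlace_zero_zero, rfl⟩
    have hc : ∀ b : InterlacingChain 0 0, b = c := fun b =>
      Subtype.ext (funext fun d => b.eq_zero (Nat.zero_le d))
    rw [chainSum, tsum_eq_single c (fun b hb => (hb (hc b)).elim)]
    simp [emptyInd]
  · have : IsEmpty (InterlacingChain 0 l) := ⟨fun c => h (c.2.1.symm.trans c.2.2.2)⟩
    simp [chainSum, emptyInd, h]

theorem chainSum_succ (q : ℝ≥0∞) (N : ℕ) (l : ℕ →₀ ℕ) :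
    chainSum q (N + 1) l = ∑' μ : {μ // Interlace μ l}, q ^ μ.1.degree * chainSum q N μ.1 := by
  let e : (Σ μ : {μ // Interlace μ l}, InterlacingChain N μ.1) → InterlacingChain (N + 1) l :=
    fun x => ⟨fun d => Nat.casesOn d l x.2.1, rfl, fun d => by
      cases d with
      | zero =>
        have h := x.1.2
        rw [← x.2.2.1] at h
        exact h
      | succ d => exact x.2.2.2.1 d, x.2.2.2.2⟩
  have he : Function.Bijective e := by
    constructor
    · rintro ⟨⟨μ, hμ⟩, c⟩ ⟨⟨ν, hν⟩, c'⟩ h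
      have h1 : c.1 = c'.1 := funext fun d => congrFun (congrArg Subtype.val h) (d + 1)
      have h2 : μ = ν := c.2.1.symm.trans ((congrFun h1 0).trans c'.2.1)
      subst h2
      rw [Subtype.ext h1]
    · rintro ⟨c, rfl, hc, hN⟩
      refine ⟨⟨⟨c 1, hc 0⟩, fun d => c (d + 1), rfl, fun d => hc (d + 1), hN⟩, Subtype.ext ?_⟩
      funext d
      cases d <;> rfl
  simp only [chainSum, ← ENNReal.tsum_mul_left]
  rw [← (Equiv.ofBijective e he).tsum_eq, ENNReal.tsum_sigma']
  refine tsum_congr fun μ => tsum_congr fun c => ?_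
  rw [Finset.sum_range_succ', add_comm, pow_add]
  have : (e ⟨μ, c⟩).1 (0 + 1) = μ.1 := c.2.1
  change q ^ ((e ⟨μ, c⟩).1 (0 + 1)).degree * _ = _
  rw [this]
  rfl

/-- Abel summation: `∑ (s + d) (|c d| - |c (d + 1)|) = s |c 0| + ∑_{d ≥ 1} |c d|` for a chain `c`,
so consecutive powers of `q` as variables weight a chain by its total degree. -/
theorem upList_range' (q : ℝ≥0∞) (N s : ℕ) (l : ℕ →₀ ℕ) :
    upList ((List.range' s N).map (q ^ ·)) l = q ^ (s * l.degree) * chainSum q N l := by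
  induction N generalizing s l with
  | zero =>
    change emptyInd l = _
    rw [chainSum_zero]
    by_cases h : l = 0 <;> simp [h, emptyInd]
  | succ N ih =>
    change upOp (q ^ s) (upList ((List.range' (s + 1) N).map (q ^ ·))) l = _
    rw [chainSum_succ, upOp, ← ENNReal.tsum_mul_left]
    refine Eq.trans (tsum_congr fun μ => ?_) (tsum_subtype {μ | Interlace μ l}
      (fun μ => q ^ (s * l.degree) * (q ^ μ.degree * chainSum q N μ))).symm
    rw [ih]
    by_cases h : Interlace μ l
    · have h1 := h.degree_le
      simp only [interlaceKernel, h, if_true, Set.indicator, Set.mem_ofPred_eq]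
      rw [← mul_assoc, ← mul_assoc, ← pow_mul, ← pow_add, ← pow_add]
      congr 2
      obtain ⟨t, ht⟩ := Nat.exists_eq_add_of_le h1
      rw [ht, Nat.add_sub_cancel_left]
      ring
    · simp [interlaceKernel, h]

/-- Plane partitions whose first coordinates are less than `N` and whose second coordinates are
less than `R`. -/
def BoxPlanePartition (N R : ℕ) : Type :=
  {π : ℕ × ℕ →₀ ℕ // Antitone π ∧ (∀ c : ℕ × ℕ, N ≤ c.1 → π c = 0) ∧
    ∀ c : ℕ × ℕ, R ≤ c.2 → π c = 0}

theorem mapDomain_shift_left_apply (f : ℕ →₀ ℕ) (e a i : ℕ) :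
    f.mapDomain (fun k => (k + e, k)) (a, i) = if a = i + e then f i else 0 := by
  split_ifs with h
  · subst h
    exact Finsupp.mapDomain_apply (f := fun k : ℕ => (k + e, k))
      (fun x y h => (Prod.ext_iff.1 h).2) f i
  · refine Finsupp.mapDomain_of_notMem_range _ _ ?_
    rintro ⟨k, hk⟩
    simp only [Prod.mk.injEq] at hk
    omega

theorem mapDomain_shift_right_apply (f : ℕ →₀ ℕ) (e a i : ℕ) :
    f.mapDomain (fun k => (k, k + e)) (a, i) = if i = a + e then f a else 0 := by
  split_ifs with h
  · subst h
    exact Finsupp.mapDomain_apply (f := fun k : ℕ => (k, k + e))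
      (fun x y h => (Prod.ext_iff.1 h).1) f a
  · refine Finsupp.mapDomain_of_notMem_range _ _ ?_
    rintro ⟨k, hk⟩
    simp only [Prod.mk.injEq] at hk
    omega

/-- The array whose diagonals are the sequences of two interlacing chains. -/
noncomputable def ofDiagonals (N R : ℕ) (c c' : ℕ → ℕ →₀ ℕ) : ℕ × ℕ →₀ ℕ :=
  (c 0).mapDomain (fun k => (k + 0, k)) +
    ∑ d ∈ Finset.range N, (c (d + 1)).mapDomain (fun k => (k + (d + 1), k)) +
    ∑ d ∈ Finset.range R, (c' (d + 1)).mapDomain (fun k => (k, k + (d + 1)))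

theorem degree_ofDiagonals (N R : ℕ) (c c' : ℕ → ℕ →₀ ℕ) :
    (ofDiagonals N R c c').degree = (c 0).degree + ∑ d ∈ Finset.range N, (c (d + 1)).degree +
      ∑ d ∈ Finset.range R, (c' (d + 1)).degree := by
  simp only [ofDiagonals, map_add, map_sum, Finsupp.degree_mapDomain]

theorem ofDiagonals_left {N R : ℕ} {c c' : ℕ → ℕ →₀ ℕ} (h : ∀ d, N ≤ d → c d = 0) (d k : ℕ) :
    ofDiagonals N R c c' (k + d, k) = c d k := by
  simp only [ofDiagonals, Finsupp.add_apply, Finsupp.finsetSum_apply, mapDomain_shift_left_apply,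
    mapDomain_shift_right_apply]
  rw [Finset.sum_eq_zero (s := Finset.range R) fun e _ => if_neg (by omega)]
  cases d with
  | zero =>
    rw [Finset.sum_eq_zero fun e _ => if_neg (by omega)]
    simp
  | succ d =>
    rw [if_neg (by omega), Finset.sum_eq_single d (fun e _ he => if_neg (by omega))]
    · simp
    · intro hd
      rw [h (d + 1) (by rw [Finset.mem_range] at hd; omega)]
      simp

theorem ofDiagonals_right {N R : ℕ} {c c' : ℕ → ℕ →₀ ℕ} (h : ∀ d, R ≤ d → c' d = 0)
    (h0 : c' 0 = c 0) (d k : ℕ) : ofDiagonals N R c c' (k, k + d) = c' d k := by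
  simp only [ofDiagonals, Finsupp.add_apply, Finsupp.finsetSum_apply, mapDomain_shift_left_apply,
    mapDomain_shift_right_apply]
  rw [Finset.sum_eq_zero (s := Finset.range N) fun e _ => if_neg (by omega)]
  cases d with
  | zero =>
    rw [Finset.sum_eq_zero fun e _ => if_neg (by omega)]
    simp [h0]
  | succ d =>
    rw [if_neg (by omega), Finset.sum_eq_single d (fun e _ he => if_neg (by omega))]
    · simp
    · intro hd
      rw [h (d + 1) (by rw [Finset.mem_range] at hd; omega)]
      simp

theorem antitone_prod_nat {f : ℕ × ℕ → ℕ} (h1 : ∀ a i, f (a + 1, i) ≤ f (a, i))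
    (h2 : ∀ a i, f (a, i + 1) ≤ f (a, i)) : Antitone f := by
  rintro ⟨a, i⟩ ⟨b, j⟩ ⟨hab, hij⟩
  exact (antitone_nat_of_succ_le (f := fun a => f (a, j)) (fun a => h1 a j) hab).trans
    (antitone_nat_of_succ_le (f := fun i => f (a, i)) (h2 a) hij)

theorem antitone_ofDiagonals {N R : ℕ} {c c' : ℕ → ℕ →₀ ℕ} (h : ∀ d, N ≤ d → c d = 0)
    (h' : ∀ d, R ≤ d → c' d = 0) (h0 : c' 0 = c 0) (hc : ∀ d, Interlace (c (d + 1)) (c d))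
    (hc' : ∀ d, Interlace (c' (d + 1)) (c' d)) : Antitone (ofDiagonals N R c c') := by
  have left := fun d k => ofDiagonals_left (R := R) (c' := c') h d k
  have right := fun d k => ofDiagonals_right (N := N) h' h0 d k
  refine antitone_prod_nat (fun a i => ?_) fun a i => ?_
  · rcases le_or_gt i a with hia | hia
    · obtain ⟨d, rfl⟩ := Nat.exists_eq_add_of_le hia
      rw [left, add_assoc, left]
      exact (hc d i).1
    · obtain ⟨d, rfl⟩ := Nat.exists_eq_add_of_lt hia
      rw [add_assoc a d 1, right, show a + (d + 1) = a + 1 + d by ring, right]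
      exact (hc' d a).2
  · rcases le_or_gt a i with hia | hia
    · obtain ⟨d, rfl⟩ := Nat.exists_eq_add_of_le hia
      rw [right, add_assoc, right]
      exact (hc' d a).1
    · obtain ⟨d, rfl⟩ := Nat.exists_eq_add_of_lt hia
      rw [add_assoc i d 1, left, show i + (d + 1) = i + 1 + d by ring, left]
      exact (hc d i).2

theorem ofDiagonals_eq_zero_left {N R : ℕ} {c c' : ℕ → ℕ →₀ ℕ} (h : ∀ d, N ≤ d → c d = 0)
    (h' : ∀ d, R ≤ d → c' d = 0) (h0 : c' 0 = c 0) (hc : ∀ d, Interlace (c (d + 1)) (c d))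
    (hc' : ∀ d, Interlace (c' (d + 1)) (c' d)) {x : ℕ × ℕ} (hx : N ≤ x.1) :
    ofDiagonals N R c c' x = 0 := by
  have h1 := antitone_ofDiagonals h h' h0 hc hc'
    (show (0 + x.1, 0) ≤ x from ⟨by simp, Nat.zero_le _⟩)
  rw [ofDiagonals_left h, h _ hx] at h1
  exact Nat.le_zero.1 h1

theorem ofDiagonals_eq_zero_right {N R : ℕ} {c c' : ℕ → ℕ →₀ ℕ} (h : ∀ d, N ≤ d → c d = 0)
    (h' : ∀ d, R ≤ d → c' d = 0) (h0 : c' 0 = c 0) (hc : ∀ d, Interlace (c (d + 1)) (c d))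
    (hc' : ∀ d, Interlace (c' (d + 1)) (c' d)) {x : ℕ × ℕ} (hx : R ≤ x.2) :
    ofDiagonals N R c c' x = 0 := by
  have h1 := antitone_ofDiagonals h h' h0 hc hc'
    (show (0, 0 + x.2) ≤ x from ⟨Nat.zero_le _, by simp⟩)
  rw [ofDiagonals_right h' h0, h' _ hx] at h1
  exact Nat.le_zero.1 h1

/-- The main diagonal is `l`; the diagonals on its two sides form the two chains. Monotonicity of
the array in both coordinates is precisely interlacing of neighbouring diagonals. -/
theorem tsum_boxPlanePartition (q : ℝ≥0∞) (N R : ℕ) :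
    ∑' π : BoxPlanePartition N R, q ^ π.1.degree =
      ∑' l, q ^ l.degree * chainSum q N l * chainSum q R l := by
  let e : (Σ l, InterlacingChain N l × InterlacingChain R l) → BoxPlanePartition N R :=
    fun x => ⟨ofDiagonals N R x.2.1.1 x.2.2.1,
      antitone_ofDiagonals (fun _ => x.2.1.eq_zero) (fun _ => x.2.2.eq_zero)
        (x.2.2.2.1.trans x.2.1.2.1.symm) x.2.1.2.2.1 x.2.2.2.2.1,
      fun _ => ofDiagonals_eq_zero_left (fun _ => x.2.1.eq_zero) (fun _ => x.2.2.eq_zero)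
        (x.2.2.2.1.trans x.2.1.2.1.symm) x.2.1.2.2.1 x.2.2.2.2.1,
      fun _ => ofDiagonals_eq_zero_right (fun _ => x.2.1.eq_zero) (fun _ => x.2.2.eq_zero)
        (x.2.2.2.1.trans x.2.1.2.1.symm) x.2.1.2.2.1 x.2.2.2.2.1⟩
  have he : Function.Bijective e := by
    constructor
    · rintro ⟨l, c, c'⟩ ⟨m, b, b'⟩ h
      have h1 : c.1 = b.1 := funext fun d => Finsupp.ext fun k => by
        have := DFunLike.congr_fun (congrArg Subtype.val h) (k + d, k)
        change ofDiagonals N R c.1 c'.1 _ = ofDiagonals N R b.1 b'.1 _ at this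
        rwa [ofDiagonals_left (fun _ => c.eq_zero), ofDiagonals_left (fun _ => b.eq_zero)] at this
      have h2 : c'.1 = b'.1 := funext fun d => Finsupp.ext fun k => by
        have := DFunLike.congr_fun (congrArg Subtype.val h) (k, k + d)
        change ofDiagonals N R c.1 c'.1 _ = ofDiagonals N R b.1 b'.1 _ at this
        rwa [ofDiagonals_right (fun _ => c'.eq_zero) (c'.2.1.trans c.2.1.symm),
          ofDiagonals_right (fun _ => b'.eq_zero) (b'.2.1.trans b.2.1.symm)] at this
      have h3 : l = m := c.2.1.symm.trans ((congrFun h1 0).trans b.2.1)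
      subst h3
      rw [Subtype.ext h1, Subtype.ext h2]
    · rintro ⟨π, hπ, hN, hR⟩
      have i1 : ∀ d, Function.Injective fun k : ℕ => (k + d, k) :=
        fun d x y h => (Prod.ext_iff.1 h).2
      have i2 : ∀ d, Function.Injective fun k : ℕ => (k, k + d) :=
        fun d x y h => (Prod.ext_iff.1 h).1
      let c : InterlacingChain N (π.comapDomain (fun k : ℕ => (k, k)) (i1 0).injOn) :=
        ⟨fun d => π.comapDomain (fun k => (k + d, k)) (i1 d).injOn, rfl,
          fun d k => ⟨hπ ⟨by simp, le_rfl⟩, hπ ⟨by dsimp only; omega, by simp⟩⟩,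
          Finsupp.ext fun k => hN _ (by simp)⟩
      let c' : InterlacingChain R (π.comapDomain (fun k : ℕ => (k, k)) (i1 0).injOn) :=
        ⟨fun d => π.comapDomain (fun k => (k, k + d)) (i2 d).injOn, rfl,
          fun d k => ⟨hπ ⟨le_rfl, by simp⟩, hπ ⟨by simp, by dsimp only; omega⟩⟩,
          Finsupp.ext fun k => hR _ (by simp)⟩
      refine ⟨⟨_, c, c'⟩, Subtype.ext (Finsupp.ext ?_)⟩
      rintro ⟨a, i⟩
      change ofDiagonals N R c.1 c'.1 (a, i) = π (a, i)
      rcases le_total i a with h | h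
      · obtain ⟨d, rfl⟩ := Nat.exists_eq_add_of_le h
        rw [ofDiagonals_left (fun _ => c.eq_zero)]
        rfl
      · obtain ⟨d, rfl⟩ := Nat.exists_eq_add_of_le h
        rw [ofDiagonals_right (fun _ => c'.eq_zero) (c'.2.1.trans c.2.1.symm)]
        rfl
  rw [← (Equiv.ofBijective e he).tsum_eq, ENNReal.tsum_sigma']
  refine tsum_congr fun l => ?_
  rw [ENNReal.tsum_prod', mul_assoc]
  simp only [chainSum, ← ENNReal.tsum_mul_left, ← ENNReal.tsum_mul_right]
  rw [ENNReal.tsum_comm]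
  refine tsum_congr fun c' => tsum_congr fun c => ?_
  change q ^ (ofDiagonals N R c.1 c'.1).degree = _
  rw [degree_ofDiagonals, c.2.1, pow_add, pow_add, mul_assoc]

/-- **MacMahon's formula** for plane partitions with at most `N` columns and `R` rows. -/
theorem tsum_boxPlanePartition_eq_prod (q : ℝ≥0∞) (N R : ℕ) :
    ∑' π : BoxPlanePartition N R, q ^ π.1.degree =
      ∏ c ∈ Finset.range N ×ˢ Finset.range R, (1 - q ^ (c.1 + c.2 + 1))⁻¹ := by
  -- One set of variables is `q, …, q ^ N`, the other `1, …, q ^ (R - 1)`. The different starting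
  -- exponents count the main diagonal once and produce the exponents `i + j + 1`.
  have h := tsum_upList_mul_upList ((List.range' 1 N).map (q ^ ·)) ((List.range' 0 R).map (q ^ ·))
  have h1 : ∀ n s (f : ℕ → ℝ≥0∞),
      ((List.range' s n).map f).prod = ∏ i ∈ Finset.range n, f (s + i) := by
    intro n s f
    induction n generalizing s with
    | zero => simp
    | succ n ih =>
      rw [List.range'_succ, List.map_cons, List.prod_cons, ih, Finset.prod_range_succ', mul_comm]
      simp only [add_zero]
      congr 1
      exact Finset.prod_congr rfl fun i _ => by rw [add_assoc, add_comm 1]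
  rw [tsum_boxPlanePartition]
  simp only [List.map_map, Function.comp_def, h1, upList_range'] at h
  rw [Finset.prod_product_right]
  refine Eq.trans (tsum_congr fun l => ?_) (h.trans ?_)
  · simp only [one_mul, zero_mul, pow_zero]; ring
  · refine Finset.prod_congr rfl fun i _ => Finset.prod_congr rfl fun j _ => ?_
    rw [← pow_add]
    congr 3
    ring

/-- The weight of an array, the cell `(i, l)` having weight `i + l + 1`. -/
noncomputable def cellWeight (E : ℕ × ℕ →₀ ℕ) : ℕ := E.sum fun c k => (c.1 + c.2 + 1) * k

theorem tsum_box_cellWeight (q : ℝ≥0∞) (N R : ℕ) :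
    ∑' E : {E : ℕ × ℕ →₀ ℕ // E.support ⊆ Finset.range N ×ˢ Finset.range R},
      q ^ cellWeight E.1 = ∏ c ∈ Finset.range N ×ˢ Finset.range R, (1 - q ^ (c.1 + c.2 + 1))⁻¹ := by
  have h := tsum_finsupp_prod_of_support_subset
    (fun (c : ℕ × ℕ) k => (q ^ (c.1 + c.2 + 1)) ^ k) (fun c => pow_zero _)
    (Finset.range N ×ˢ Finset.range R)
  simp only [ENNReal.tsum_geometric] at h
  rw [← h]
  refine tsum_congr fun E => ?_
  rw [cellWeight, Finsupp.sum, Finsupp.prod, ← Finset.prod_pow_eq_pow_sum]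
  exact Finset.prod_congr rfl fun c _ => pow_mul _ _ _

/-- All cells preceding `c` in its row, or in its column, also carry nonzero entries. It makes a
plane partition of `n` fit into an `n × n` box. -/
theorem lt_degree_of_antitone {π : ℕ × ℕ →₀ ℕ} (hπ : Antitone π) {c : ℕ × ℕ} (hc : π c ≠ 0) :
    c.1 < π.degree ∧ c.2 < π.degree := by
  have key : ∀ (n : ℕ) (f : ℕ ↪ ℕ × ℕ), (∀ a < n, f a ≤ c) → n ≤ π.degree := by
    intro n f hf
    have h1 : (Finset.range n).map f ⊆ π.support := by
      intro x hx
      obtain ⟨a, ha, rfl⟩ := Finset.mem_map.1 hx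
      have := hπ (hf a (Finset.mem_range.1 ha))
      rw [Finsupp.mem_support_iff]
      omega
    have h2 := Finset.card_le_card h1
    rw [Finset.card_map, Finset.card_range] at h2
    refine h2.trans ?_
    rw [Finsupp.degree_apply, Finset.card_eq_sum_ones]
    exact Finset.sum_le_sum fun x hx => Nat.one_le_iff_ne_zero.2 (Finsupp.mem_support_iff.1 hx)
  exact ⟨key (c.1 + 1) ⟨fun a => (a, c.2), fun x y h => (Prod.ext_iff.1 h).1⟩
      fun a ha => ⟨Nat.lt_succ_iff.1 ha, le_rfl⟩,
    key (c.2 + 1) ⟨fun a => (c.1, a), fun x y h => (Prod.ext_iff.1 h).2⟩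
      fun a ha => ⟨le_rfl, Nat.lt_succ_iff.1 ha⟩⟩

theorem le_cellWeight {E : ℕ × ℕ →₀ ℕ} {c : ℕ × ℕ} (hc : E c ≠ 0) :
    c.1 + c.2 + 1 ≤ cellWeight E := by
  calc c.1 + c.2 + 1 ≤ (c.1 + c.2 + 1) * E c := Nat.le_mul_of_pos_right _ (Nat.pos_of_ne_zero hc)
    _ ≤ cellWeight E := Finset.single_le_sum (f := fun c : ℕ × ℕ => (c.1 + c.2 + 1) * E c)
        (fun _ _ => Nat.zero_le _) (Finsupp.mem_support_iff.2 hc)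

/-- Plane partitions of `n` with at most `r` rows. -/
abbrev PlanePartitions (r : ℕ∞) (n : ℕ) : Type :=
  {π : ℕ × ℕ →₀ ℕ // Antitone π ∧ (∀ c : ℕ × ℕ, r ≤ (c.2 : ℕ∞) → π c = 0) ∧ π.degree = n}

/-- Arrays of weight `n` with at most `r` rows. -/
abbrev WeightedArrays (r : ℕ∞) (n : ℕ) : Type :=
  {E : ℕ × ℕ →₀ ℕ // (∀ c : ℕ × ℕ, r ≤ (c.2 : ℕ∞) → E c = 0) ∧ cellWeight E = n}

/-- **MacMahon's theorem**: plane partitions of `n` with at most `r` rows, where `r` may be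
infinite, are equinumerous with arrays of weight `n` with at most `r` rows. -/
theorem planePartitions_equiv_weightedArrays (r : ℕ∞) (n : ℕ) :
    Nonempty (PlanePartitions r n ≃ WeightedArrays r n) ∧ Finite (PlanePartitions r n) := by
  -- Neither a plane partition of `n` nor an array of weight `n` leaves the first `n` rows, so `min
  -- r n` rows suffice and the case `r = ⊤` becomes finite.
  obtain ⟨R, hR⟩ : ∃ R : ℕ, (R : ℕ∞) = min r n :=
    ⟨(min r n).toNat, ENat.natCast_toNat (ne_top_of_le_ne_top (ENat.natCast_ne_top n) (min_le_right _ _))⟩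
  have hR' : ∀ m : ℕ, R ≤ m ↔ r ≤ (m : ℕ∞) ∨ n ≤ m := fun m => by
    rw [← ENat.natCast_le_natCast, hR, min_le_iff, ENat.natCast_le_natCast]
  obtain ⟨⟨e⟩, hfin⟩ := nonempty_equiv_fiber_of_tsum_pow_eq
    (fun π : BoxPlanePartition n R => π.1.degree)
    (fun E : {E : ℕ × ℕ →₀ ℕ // E.support ⊆ Finset.range n ×ˢ Finset.range R} => cellWeight E.1)
    (fun q _ => by rw [tsum_boxPlanePartition_eq_prod, tsum_box_cellWeight])
    (fun q hq => by
      rw [tsum_box_cellWeight]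
      refine ENNReal.prod_ne_top fun c _ => ENNReal.inv_ne_top.2 ?_
      rw [← pos_iff_ne_zero, tsub_pos_iff_lt]
      exact pow_lt_one₀ zero_le (by exact_mod_cast hq) (by omega)) n
  let e1 : {π : BoxPlanePartition n R // π.1.degree = n} ≃ PlanePartitions r n :=
    { toFun := fun π => ⟨π.1.1, π.1.2.1,
        fun c hc => π.1.2.2.2 c ((hR' _).2 (Or.inl hc)), π.2⟩
      invFun := fun π => ⟨⟨π.1, π.2.1, fun c hc => by
          by_contra h
          have := (lt_degree_of_antitone π.2.1 h).1
          rw [π.2.2.2] at this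
          omega, fun c hc => by
          rcases (hR' _).1 hc with h | h
          · exact π.2.2.1 c h
          · by_contra h'
            have := (lt_degree_of_antitone π.2.1 h').2
            rw [π.2.2.2] at this
            omega⟩, π.2.2.2⟩
      left_inv := fun _ => rfl
      right_inv := fun _ => rfl }
  let e2 : {E : {E : ℕ × ℕ →₀ ℕ // E.support ⊆ Finset.range n ×ˢ Finset.range R} //
      cellWeight E.1 = n} ≃ WeightedArrays r n :=
    { toFun := fun E => ⟨E.1.1, fun c hc => by
          by_contra h
          have h1 := E.1.2 (Finsupp.mem_support_iff.2 h)
          have h2 := (hR' _).2 (Or.inl hc)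
          simp only [Finset.mem_product, Finset.mem_range] at h1
          omega, E.2⟩
      invFun := fun E => ⟨⟨E.1, fun c hc => by
          have h1 := Finsupp.mem_support_iff.1 hc
          have h2 := le_cellWeight h1
          rw [E.2.2] at h2
          simp only [Finset.mem_product, Finset.mem_range]
          refine ⟨by omega, ?_⟩
          by_contra h
          rcases (hR' _).1 (not_lt.1 h) with h | h
          · exact h1 (E.2.1 c h)
          · omega⟩, E.2.2⟩
      left_inv := fun _ => rfl
      right_inv := fun _ => rfl }
  exact ⟨⟨(e1.symm.trans e).trans e2⟩, Finite.of_equiv _ e1⟩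

/-! ### Ranks and embeddings of finite abelian groups -/

/-- The elements of `p ^ a G` killed by `p`. -/
abbrev PowerSocle (p a : ℕ) (G : Type*) [AddCommGroup G] : Type _ :=
  {x : G // p • x = 0 ∧ ∃ y, p ^ a • y = x}

/-- For a finite abelian group `G`, the number of cyclic summands of order divisible by
`p ^ (a + 1)` in a decomposition of `G` into cyclic groups of prime power order. -/
noncomputable def primaryRank (p a : ℕ) (G : Type*) [AddCommGroup G] : ℕ :=
  Nat.log p (Nat.card (PowerSocle p a G))

/-- The socle of `p ^ a G` is defined without choosing a decomposition, so an injection restricts to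
it. This is the reason for defining the rank as a logarithm of a cardinality. -/
theorem primaryRank_le_of_injective {G H : Type*} [AddCommGroup G] [AddCommGroup H] [Finite G]
    (f : H →+ G) (hf : Function.Injective f) (p a : ℕ) : primaryRank p a H ≤ primaryRank p a G := by
  refine Nat.log_mono_right (Nat.card_le_card_of_injective
    (fun x => ⟨f x.1, by rw [← map_nsmul, x.2.1, map_zero], by
      obtain ⟨y, hy⟩ := x.2.2
      exact ⟨f y, by rw [← map_nsmul, hy]⟩⟩) ?_)
  intro x y h
  exact Subtype.ext (hf (congrArg Subtype.val h))

theorem primaryRank_congr {G H : Type*} [AddCommGroup G] [AddCommGroup H] [Finite G]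
    (e : G ≃+ H) (p a : ℕ) : primaryRank p a G = primaryRank p a H := by
  have : Finite H := Finite.of_equiv _ e.toEquiv
  exact le_antisymm (primaryRank_le_of_injective e.toAddMonoidHom e.injective p a)
    (primaryRank_le_of_injective e.symm.toAddMonoidHom e.symm.injective p a)

theorem primaryRank_succ_le {G : Type*} [AddCommGroup G] [Finite G] (p a : ℕ) :
    primaryRank p (a + 1) G ≤ primaryRank p a G := by
  refine Nat.log_mono_right (Nat.card_le_card_of_injective
    (fun x => ⟨x.1, x.2.1, by
      obtain ⟨y, hy⟩ := x.2.2
      exact ⟨p • y, by rw [← mul_nsmul', mul_comm, ← pow_succ', hy]⟩⟩) ?_)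
  intro x y h
  exact Subtype.ext (Subtype.mk.inj h)

theorem card_powerSocle_pi {ι : Type*} [Fintype ι] (A : ι → Type*) [∀ i, AddCommGroup (A i)]
    (p a : ℕ) :
    Nat.card (PowerSocle p a (∀ i, A i)) = ∏ i, Nat.card (PowerSocle p a (A i)) := by
  rw [← Nat.card_pi]
  refine Nat.card_congr
    { toFun := fun x i => ⟨x.1 i, congrFun x.2.1 i, by
        obtain ⟨y, hy⟩ := x.2.2
        exact ⟨y i, congrFun hy i⟩⟩
      invFun := fun x => ⟨fun i => (x i).1, funext fun i => (x i).2.1, by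
        choose y hy using fun i => (x i).2.2
        exact ⟨y, funext hy⟩⟩
      left_inv := fun _ => rfl
      right_inv := fun _ => rfl }

/-- If `q = p` and `a < e`, the elements killed by `p` are the `p` multiples of `p ^ (e - 1)`, all
of them in the image of `p ^ a`. Otherwise either `p ^ a` is zero in the ring or `p` is a unit, and
only zero remains. -/
theorem card_powerSocle_zmod {p q : ℕ} (hp : p.Prime) (hq : q.Prime) (a e : ℕ) :
    Nat.card (PowerSocle p a (ZMod (q ^ e))) = if q = p ∧ a < e then p else 1 := by
  have hone : (∀ x : ZMod (q ^ e), p • x = 0 → (∃ y, p ^ a • y = x) → x = 0) →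
      Nat.card (PowerSocle p a (ZMod (q ^ e))) = 1 := by
    intro h
    rw [Nat.card_eq_one_iff_unique]
    exact ⟨⟨fun x y => Subtype.ext ((h _ x.2.1 x.2.2).trans (h _ y.2.1 y.2.2).symm)⟩,
      ⟨⟨0, by simp, 0, by simp⟩⟩⟩
  split_ifs with h
  · obtain ⟨rfl, hae⟩ := h
    obtain ⟨d, rfl⟩ := Nat.exists_eq_add_of_lt hae
    have : NeZero (q ^ (a + d + 1)) := ⟨pow_ne_zero _ hq.ne_zero⟩
    have hpow : q ^ (a + d + 1) = q ^ (a + d) * q := pow_succ _ _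
    let f : Fin q → PowerSocle q a (ZMod (q ^ (a + d + 1))) := fun k =>
      ⟨((q ^ (a + d) * k : ℕ) : ZMod (q ^ (a + d + 1))), by
        rw [nsmul_eq_mul, ← Nat.cast_mul, ZMod.natCast_eq_zero_iff]
        exact ⟨k, by rw [hpow]; ring⟩, ((q ^ d * k : ℕ) : ZMod (q ^ (a + d + 1))), by
        rw [nsmul_eq_mul, ← Nat.cast_mul, ← mul_assoc, ← pow_add]⟩
    have hf : Function.Bijective f := by
      constructor
      · intro x y h
        have h1 := congrArg (fun z => ZMod.val z.1) h
        have hlt : ∀ x : Fin q, q ^ (a + d) * x < q ^ (a + d + 1) := fun x => by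
          rw [hpow]
          exact Nat.mul_lt_mul_of_pos_left x.2 (pow_pos hq.pos _)
        simp only [f, ZMod.val_cast_of_lt (hlt _)] at h1
        exact Fin.ext (Nat.eq_of_mul_eq_mul_left (pow_pos hq.pos _) h1)
      · rintro ⟨x, hx, hx'⟩
        have h1 : q ^ (a + d + 1) ∣ q * x.val := by
          rw [← ZMod.natCast_eq_zero_iff, Nat.cast_mul, ZMod.natCast_zmod_val, ← nsmul_eq_mul, hx]
        obtain ⟨k, hk⟩ := Nat.dvd_of_mul_dvd_mul_left hq.pos ((pow_succ' q (a + d)).symm.dvd.trans h1)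
        have h2 := ZMod.val_lt x
        rw [hk, hpow] at h2
        refine ⟨⟨k, Nat.lt_of_mul_lt_mul_left h2⟩, Subtype.ext ?_⟩
        change ((q ^ (a + d) * k : ℕ) : ZMod (q ^ (a + d + 1))) = x
        rw [← hk, ZMod.natCast_zmod_val]
    rw [← Nat.card_eq_of_bijective f hf, Nat.card_fin]
  · refine hone fun x hx hx' => ?_
    by_cases hqp : q = p
    · subst hqp
      obtain ⟨y, rfl⟩ := hx'
      have hle : e ≤ a := by
        by_contra h'
        exact h ⟨rfl, by omega⟩
      rw [nsmul_eq_mul, (ZMod.natCast_eq_zero_iff _ _).2 (pow_dvd_pow q hle), zero_mul]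
    · have : IsUnit ((p : ℕ) : ZMod (q ^ e)) := by
        rw [ZMod.isUnit_iff_coprime]
        exact Nat.Coprime.pow_right _ ((Nat.coprime_primes hp hq).2 (Ne.symm hqp))
      rw [nsmul_eq_mul] at hx
      exact this.mul_right_eq_zero.1 hx

/-- The primary rank counts cyclic summands. -/
theorem primaryRank_eq_card {G : Type*} [AddCommGroup G] [Finite G] {ι : Type*} [Fintype ι]
    {q e : ι → ℕ} (hq : ∀ i, (q i).Prime) (φ : G ≃+ ∀ i, ZMod (q i ^ e i)) {p : ℕ} (hp : p.Prime)
    (a : ℕ) : primaryRank p a G = (Finset.univ.filter fun i => q i = p ∧ a < e i).card := by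
  rw [primaryRank_congr φ, primaryRank, card_powerSocle_pi]
  simp only [card_powerSocle_zmod hp (hq _)]
  rw [Finset.prod_ite, Finset.prod_const, Finset.prod_const_one, mul_one, Nat.log_pow hp.one_lt]

theorem exists_equiv_pi_zmod (G : Type*) [AddCommGroup G] [Finite G] :
    ∃ (ι : Type) (_ : Fintype ι) (q e : ι → ℕ), (∀ i, (q i).Prime) ∧
      Nonempty (G ≃+ ∀ i, ZMod (q i ^ e i)) := by
  classical
  obtain ⟨ι, hι, q, hq, e, ⟨φ⟩⟩ := AddCommGroup.equiv_directSum_zmod_of_finite G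
  exact ⟨ι, hι, q, e, hq, ⟨φ.trans (DirectSum.addEquivProd _)⟩⟩

theorem factorization_card_eq_sum {G : Type*} [AddCommGroup G] {ι : Type*} [Fintype ι]
    {q e : ι → ℕ} (hq : ∀ i, (q i).Prime) (φ : G ≃+ ∀ i, ZMod (q i ^ e i)) (p : ℕ) :
    (Nat.card G).factorization p = ∑ i, if q i = p then e i else 0 := by
  rw [Nat.card_congr φ.toEquiv, Nat.card_pi]
  simp only [Nat.card_zmod]
  rw [Nat.factorization_prod fun i _ => pow_ne_zero _ (hq i).ne_zero, Finsupp.finsetSum_apply]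
  refine Finset.sum_congr rfl fun i _ => ?_
  rw [(hq i).factorization_pow, Finsupp.single_apply]

theorem primaryRank_eq_zero {G : Type*} [AddCommGroup G] [Finite G] {p : ℕ} (hp : p.Prime)
    {a : ℕ} (ha : (Nat.card G).factorization p ≤ a) : primaryRank p a G = 0 := by
  obtain ⟨ι, _, q, e, hq, ⟨φ⟩⟩ := exists_equiv_pi_zmod G
  rw [primaryRank_eq_card hq φ hp, Finset.card_eq_zero, Finset.filter_eq_empty_iff]
  rintro i - ⟨h1, h2⟩
  rw [factorization_card_eq_sum hq φ] at ha
  have := Finset.single_le_sum (f := fun i => if q i = p then e i else 0)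
    (fun _ _ => Nat.zero_le _) (Finset.mem_univ i)
  simp only [h1, if_true] at this
  omega

/-- Double counting: a summand of order `p ^ e` is counted once for each `a < e`. -/
theorem sum_primaryRank {G : Type*} [AddCommGroup G] [Finite G] {p : ℕ} (hp : p.Prime)
    {B : ℕ} (hB : (Nat.card G).factorization p ≤ B) :
    ∑ a ∈ Finset.range B, primaryRank p a G = (Nat.card G).factorization p := by
  obtain ⟨ι, _, q, e, hq, ⟨φ⟩⟩ := exists_equiv_pi_zmod G
  rw [factorization_card_eq_sum hq φ] at hB ⊢
  simp only [primaryRank_eq_card hq φ hp, Finset.card_filter]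
  rw [Finset.sum_comm]
  refine Finset.sum_congr rfl fun i _ => ?_
  by_cases h : q i = p
  · have := Finset.single_le_sum (f := fun i => if q i = p then e i else 0)
      (fun _ _ => Nat.zero_le _) (Finset.mem_univ i)
    simp only [h, if_true, true_and] at this ⊢
    rw [← Finset.card_filter]
    have h1 : (Finset.range B).filter (fun a => a < e i) = Finset.range (e i) := by
      ext a
      simp only [Finset.mem_filter, Finset.mem_range]
      omega
    rw [h1, Finset.card_range]
  · simp [h]

theorem exists_injective_zmod_hom {m n : ℕ} (hn : n ≠ 0) (h : m ∣ n) :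
    ∃ f : ZMod m →+ ZMod n, Function.Injective f := by
  obtain ⟨k, rfl⟩ := h
  have hk : k ≠ 0 := right_ne_zero_of_mul hn
  refine ⟨ZMod.lift m ⟨(zmultiplesHom _) (k : ZMod (m * k)), ?_⟩, ?_⟩
  · rw [zmultiplesHom_apply, natCast_zsmul, nsmul_eq_mul, ← Nat.cast_mul, ZMod.natCast_self]
  · rw [ZMod.lift_injective]
    intro z hz
    simp only [zmultiplesHom_apply, zsmul_eq_mul] at hz
    have h1 : ((z * k : ℤ) : ZMod (m * k)) = 0 := by exact_mod_cast hz
    rw [ZMod.intCast_zmod_eq_zero_iff_dvd, Nat.cast_mul] at h1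
    rw [ZMod.intCast_zmod_eq_zero_iff_dvd]
    exact Int.dvd_of_mul_dvd_mul_right (by exact_mod_cast hk) h1

/-- Hall's marriage theorem, matching each nontrivial summand of the smaller group with a summand of
the larger one for the same prime and with at least its exponent. Different primes compete for
disjoint sets, so Hall's condition is checked prime by prime. -/
theorem exists_injective_of_card_le {ι κ : Type*} [Fintype ι] [Fintype κ] (q e : ι → ℕ)
    (q' e' : κ → ℕ)
    (h : ∀ j a, (Finset.univ.filter fun k => q' k = q' j ∧ a < e' k).card ≤
      (Finset.univ.filter fun i => q i = q' j ∧ a < e i).card) :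
    ∃ f : {j // e' j ≠ 0} → ι, Function.Injective f ∧ ∀ j, q (f j) = q' j ∧ e' j ≤ e (f j) := by
  classical
  let t : {j // e' j ≠ 0} → Finset ι := fun j =>
    Finset.univ.filter fun i => q i = q' j ∧ e' j ≤ e i
  obtain ⟨f, hf, hft⟩ := (Finset.all_card_le_biUnion_card_iff_exists_injective t).1 (by
    intro S
    rw [Finset.card_eq_sum_card_fiberwise (f := fun j => q' j.1) (s := S)
      (t := S.image fun j => q' j.1) (fun j hj => Finset.mem_image_of_mem _ hj)]
    refine le_trans (Finset.sum_le_sum (g := fun p => ((S.biUnion t).filter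
      fun i => q i = p).card) fun p hp => ?_) (by
      rw [Finset.sum_card_fiberwise_eq_card_filter]
      exact Finset.card_filter_le _ _)
    obtain ⟨j, hj, rfl⟩ := Finset.mem_image.1 hp
    -- Within one prime, the member with the least exponent has the largest set of admissible
    -- partners, and that set alone is already large enough.
    obtain ⟨k, hk, hmin⟩ := Finset.exists_min_image (S.filter fun k => q' k.1 = q' j.1)
      (fun k => e' k.1) ⟨j, by simp [hj]⟩
    rw [Finset.mem_filter] at hk
    have hk0 := k.2
    calc (S.filter fun k => q' k.1 = q' j.1).card
        = ((S.filter fun k => q' k.1 = q' j.1).map (Function.Embedding.subtype _)).card :=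
          (Finset.card_map _).symm
      -- Since `e' k ≠ 0`, the condition `e' k - 1 < e' l` says `e' k ≤ e' l`; the hypothesis is
      -- applied at `a = e' k - 1`.
      _ ≤ (Finset.univ.filter fun l => q' l = q' j ∧ e' k - 1 < e' l).card := by
          refine Finset.card_le_card fun l hl => ?_
          obtain ⟨l, hl', rfl⟩ := Finset.mem_map.1 hl
          have h1 := hmin l hl'
          have h2 := (Finset.mem_filter.1 hl').2
          simp only [Finset.mem_filter, Finset.mem_univ, true_and, Function.Embedding.subtype_apply]
          exact ⟨h2, by omega⟩
      _ ≤ _ := h _ _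
      _ ≤ _ := by
          refine Finset.card_le_card fun i hi => ?_
          simp only [Finset.mem_filter, Finset.mem_univ, true_and] at hi
          simp only [Finset.mem_filter, Finset.mem_biUnion]
          refine ⟨⟨k, hk.1, ?_⟩, hi.1⟩
          simp only [t, Finset.mem_filter, Finset.mem_univ, true_and]
          exact ⟨hi.1.trans hk.2.symm, by omega⟩)
  refine ⟨f, hf, fun j => ?_⟩
  have := hft j
  simpa only [t, Finset.mem_filter, Finset.mem_univ, true_and] using this

/-- A finite abelian group embeds into another one as soon as its primary ranks are not larger. -/
theorem exists_injective_of_primaryRank_le {G H : Type*} [AddCommGroup G] [AddCommGroup H]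
    [Finite G] [Finite H] (h : ∀ p, p.Prime → ∀ a, primaryRank p a H ≤ primaryRank p a G) :
    ∃ f : H →+ G, Function.Injective f := by
  classical
  obtain ⟨ι, _, q, e, hq, ⟨φ⟩⟩ := exists_equiv_pi_zmod G
  obtain ⟨κ, _, q', e', hq', ⟨ψ⟩⟩ := exists_equiv_pi_zmod H
  obtain ⟨f, hf, hfe⟩ := exists_injective_of_card_le q e q' e' fun j a => by
    have := h (q' j) (hq' j) a
    rwa [primaryRank_eq_card hq φ (hq' j), primaryRank_eq_card hq' ψ (hq' j)] at this
  choose g hg using fun j : {j // e' j ≠ 0} =>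
    exists_injective_zmod_hom (m := q' j ^ e' j) (n := q (f j) ^ e (f j))
      (pow_ne_zero _ (hq _).ne_zero) (by rw [(hfe j).1]; exact pow_dvd_pow _ (hfe j).2)
  let F : (∀ j, ZMod (q' j ^ e' j)) →+ ∀ i, ZMod (q i ^ e i) :=
    ∑ j : {j // e' j ≠ 0}, (AddMonoidHom.single (fun i => ZMod (q i ^ e i)) (f j)).comp
      ((g j).comp (Pi.evalAddMonoidHom _ j.1))
  have hF : ∀ x (j : {j // e' j ≠ 0}), F x (f j) = g j (x j.1) := by
    intro x j
    simp only [F, AddMonoidHom.finsetSum_apply, Finset.sum_apply, AddMonoidHom.comp_apply,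
      AddMonoidHom.single_apply, Pi.evalAddMonoidHom_apply]
    rw [Finset.sum_eq_single j (fun k _ hk => Pi.single_eq_of_ne (fun h => hk (hf h).symm) _)
      (fun h => (h (Finset.mem_univ j)).elim), Pi.single_eq_same]
  have hFi : Function.Injective F := by
    rw [injective_iff_map_eq_zero]
    intro x hx
    funext j
    by_cases hj : e' j = 0
    · have : Subsingleton (ZMod (q' j ^ e' j)) := by
        rw [hj, pow_zero]
        exact inferInstanceAs (Subsingleton (Fin 1))
      exact Subsingleton.elim _ _
    · refine (injective_iff_map_eq_zero _).1 (hg ⟨j, hj⟩) _ ?_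
      rw [← hF, hx]
      rfl
  exact ⟨φ.symm.toAddMonoidHom.comp (F.comp ψ.toAddMonoidHom),
    φ.symm.injective.comp (hFi.comp ψ.injective)⟩

/-- Conjugation of partitions: it turns prescribed ranks into exponents of cyclic summands. -/
theorem lt_card_filter_iff {l : ℕ → ℕ} (hl : Antitone l) {N : ℕ} (hN : ∀ a, N ≤ a → l a = 0)
    (a i : ℕ) : a < ((Finset.range N).filter fun b => i < l b).card ↔ i < l a := by
  constructor
  · intro h
    by_contra h'
    have : (Finset.range N).filter (fun b => i < l b) ⊆ Finset.range a := fun b hb => by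
      rw [Finset.mem_filter] at hb
      rw [Finset.mem_range]
      by_contra hab
      have := hl (not_lt.1 hab)
      omega
    have := Finset.card_le_card this
    rw [Finset.card_range] at this
    omega
  · intro h
    have : Finset.range (a + 1) ⊆ (Finset.range N).filter (fun b => i < l b) := fun b hb => by
      rw [Finset.mem_range] at hb
      have h1 := hl (Nat.lt_succ_iff.1 hb)
      rw [Finset.mem_filter, Finset.mem_range]
      refine ⟨?_, by omega⟩
      by_contra h2
      have := hN b (not_lt.1 h2)
      omega
    have := Finset.card_le_card this
    rw [Finset.card_range] at this
    omega

/-- Every family of partitions, almost all of them empty, is the family of primary ranks of a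
finite abelian group. -/
theorem exists_finAb_primaryRank_eq (l : Nat.Primes → ℕ → ℕ) (hl : ∀ p, Antitone (l p)) (N : ℕ)
    (h1 : ∀ p : Nat.Primes, N ≤ p.1 → ∀ a, l p a = 0) (h2 : ∀ p a, N ≤ a → l p a = 0) :
    ∃ A : FinAb, ∀ (p : Nat.Primes) a, primaryRank p.1 a A.carrier = l p a := by
  classical
  let P := {p : Nat.Primes // p.1 < N}
  have : Finite P := Finite.of_injective (fun p : P => (⟨p.1.1, p.2⟩ : Fin N)) fun x y h =>
    Subtype.ext (Subtype.ext (congrArg Fin.val h))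
  have := Fintype.ofFinite P
  -- A common bound for the number of nontrivial summands at each prime; the superfluous summands
  -- get exponent zero.
  let M := ∑ p : P, l p.1 0
  let q : P × Fin M → ℕ := fun x => x.1.1.1
  let e : P × Fin M → ℕ := fun x => ((Finset.range N).filter fun b => x.2.1 < l x.1.1 b).card
  have hq : ∀ x, (q x).Prime := fun x => x.1.1.2
  have : ∀ x, NeZero (q x ^ e x) := fun x => ⟨pow_ne_zero _ (hq x).ne_zero⟩
  refine ⟨⟨∀ x, ZMod (q x ^ e x)⟩, fun p a => ?_⟩
  change primaryRank p.1 a (∀ x, ZMod (q x ^ e x)) = _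
  rw [primaryRank_eq_card hq (AddEquiv.refl _) p.2]
  simp only [e, lt_card_filter_iff (hl _) (h2 _)]
  by_cases hp : p.1 < N
  · let p' : P := ⟨p, hp⟩
    have hM : l p a ≤ M := (hl p (Nat.zero_le a)).trans
      (Finset.single_le_sum (f := fun p : P => l p.1 0) (fun _ _ => Nat.zero_le _)
        (Finset.mem_univ p'))
    have : (Finset.univ.filter fun x : P × Fin M => q x = p.1 ∧ x.2.1 < l x.1.1 a) =
        Finset.univ.map ⟨fun i : Fin (l p a) => (p', Fin.castLE hM i), fun i j h => by
          simpa using (Prod.ext_iff.1 h).2⟩ := by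
      ext ⟨x, i⟩
      simp only [Finset.mem_filter, Finset.mem_univ, true_and, Finset.mem_map]
      constructor
      · rintro ⟨hx, hi⟩
        have hx' : x = p' := Subtype.ext (Subtype.ext hx)
        subst hx'
        exact ⟨⟨i.1, hi⟩, rfl⟩
      · rintro ⟨j, hj⟩
        obtain ⟨rfl, rfl⟩ := Prod.ext_iff.1 hj
        exact ⟨rfl, j.2⟩
    rw [this, Finset.card_map, Finset.card_univ, Fintype.card_fin]
  · rw [h1 p (not_lt.1 hp), Finset.card_eq_zero, Finset.filter_eq_empty_iff]
    rintro x - ⟨hx, -⟩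
    exact hp (hx ▸ x.1.2)

/-! ### Group-partitions as families of plane partitions -/

theorem FinAbClass.eq_of_addEquiv {G H : FinAbClass} (e : G.Rep ≃+ H.Rep) : G = H :=
  Quotient.out_equiv_out.1 ⟨e⟩

theorem FinAbClass.exists_addEquiv (A : FinAb) : 
    Nonempty (FinAbClass.Rep (Quotient.mk _ A) ≃+ A.carrier) :=
  Quotient.mk_out A

theorem FinAbClass.contains_iff (G H : FinAbClass) :
    G.Contains H ↔ ∀ (p : Nat.Primes) a, primaryRank p.1 a H.Rep ≤ primaryRank p.1 a G.Rep :=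
  ⟨fun ⟨f, hf⟩ p a => primaryRank_le_of_injective f hf p a,
    fun h => exists_injective_of_primaryRank_le fun p hp a => h ⟨p, hp⟩ a⟩

theorem FinAbClass.order_ne_zero (G : FinAbClass) : G.order ≠ 0 := Nat.card_pos.ne'

/-- Equal ranks give embeddings both ways, and finite groups that embed in each other are isomorphic
by cardinality. -/
theorem FinAbClass.ext_primaryRank {G H : FinAbClass}
    (h : ∀ (p : Nat.Primes) a, primaryRank p.1 a G.Rep = primaryRank p.1 a H.Rep) : G = H := by
  obtain ⟨f, hf⟩ := (contains_iff H G).2 fun p a => (h p a).le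
  obtain ⟨g, hg⟩ := (contains_iff G H).2 fun p a => (h p a).ge
  have hcard : Nat.card G.Rep = Nat.card H.Rep :=
    le_antisymm (Nat.card_le_card_of_injective f hf) (Nat.card_le_card_of_injective g hg)
  exact eq_of_addEquiv (AddEquiv.ofBijective f
    ((Nat.bijective_iff_injective_and_card f).2 ⟨hf, hcard⟩))

theorem FinAbClass.factorization_order (G : FinAbClass) (p : Nat.Primes) {B : ℕ}
    (hB : G.order.factorization p ≤ B) :
    G.order.factorization p = ∑ a ∈ Finset.range B, primaryRank p.1 a G.Rep :=
  (sum_primaryRank p.2 hB).symm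

theorem FinAbClass.order_eq_one_iff (G : FinAbClass) : G.order = 1 ↔ Subsingleton G.Rep := by
  rw [order, Nat.card_eq_one_iff_unique]
  exact ⟨fun h => h.1, fun h => ⟨h, ⟨0⟩⟩⟩

theorem FinAbClass.subsingleton_iff (G : FinAbClass) :
    Subsingleton G.Rep ↔ ∀ (p : Nat.Primes) a, primaryRank p.1 a G.Rep = 0 := by
  rw [← order_eq_one_iff]
  constructor
  · intro h p a
    refine primaryRank_eq_zero p.2 ?_
    change G.order.factorization p ≤ a
    simp [h]
  · intro h
    refine Nat.eq_of_factorization_eq G.order_ne_zero one_ne_zero fun p => ?_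
    by_cases hp : p.Prime
    · rw [G.factorization_order ⟨p, hp⟩ le_rfl]
      simp [h ⟨p, hp⟩]
    · simp [Nat.factorization_eq_zero_of_not_prime, hp]

/-- Nonzero elements chosen from distinct summands remain distinct in the finite direct sum. -/
theorem finite_setOf_nontrivial_of_finite_directSum (A : ℕ → Type*) [∀ i, AddCommGroup (A i)]
    [Finite (DirectSum ℕ A)] : ∃ N, ∀ i, N ≤ i → Subsingleton (A i) := by
  classical
  have h : ∀ i : {i // Nontrivial (A i)}, ∃ x : A i.1, x ≠ 0 := fun i => by
    have := i.2
    exact exists_ne 0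
  choose x hx using h
  have hfin : Finite {i // Nontrivial (A i)} :=
    Finite.of_injective (fun i => DirectSum.of A i.1 (x i)) fun i j hij => by
      by_contra hne
      have h1 := DFunLike.congr_fun hij i.1
      rw [DirectSum.of_eq_same, DirectSum.of_eq_of_ne _ _ _ (fun h => hne (Subtype.ext h))] at h1
      exact hx i h1
  obtain ⟨B, hB⟩ := (Set.finite_coe_iff.1 hfin : {i | Nontrivial (A i)}.Finite).bddAbove
  refine ⟨B + 1, fun i hi => ?_⟩
  rw [← not_nontrivial_iff_subsingleton]
  intro h
  have := hB h
  omega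

theorem bijective_directSum_restrict (A : ℕ → Type*) [∀ i, AddCommGroup (A i)] {N : ℕ}
    (hN : ∀ i, N ≤ i → Subsingleton (A i)) :
    Function.Bijective fun (x : DirectSum ℕ A) (i : Fin N) => x i.1 := by
  classical
  constructor
  · intro x y h
    refine DFinsupp.ext fun i => ?_
    by_cases hi : i < N
    · exact congrFun h ⟨i, hi⟩
    · have := hN i (not_lt.1 hi)
      exact Subsingleton.elim _ _
  · intro x
    refine ⟨DirectSum.mk A (Finset.range N) fun i => x ⟨i.1, Finset.mem_range.1 i.2⟩, ?_⟩
    funext i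
    exact DFinsupp.mk_of_mem (β := A)
      (x := fun i : (Finset.range N : Set ℕ) => x ⟨i.1, Finset.mem_range.1 i.2⟩)
      (Finset.mem_range.2 i.2)

theorem FinAbClass.prod_order_eq_card_directSum (P : ℕ → FinAbClass) {N : ℕ}
    (hN : ∀ i, N ≤ i → Subsingleton (P i).Rep) :
    Nat.card (DirectSum ℕ fun i => (P i).Rep) = ∏ i ∈ Finset.range N, (P i).order := by
  rw [Nat.card_eq_of_bijective _ (bijective_directSum_restrict _ hN), Nat.card_pi,
    Finset.prod_range]
  rfl

/-- The group-partitions with at most `r` factors of the groups of order `n`. -/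
def groupPartitions (r : ℕ∞) (n : ℕ) : Set (ℕ → FinAbClass) :=
  {P | (∃ G : FinAbClass, G.order = n ∧ FinAbClass.IsGroupPartition P G) ∧
    FinAbClass.AtMostFactors P r}

theorem mem_groupPartitions_iff {r : ℕ∞} {n : ℕ} {P : ℕ → FinAbClass} :
    P ∈ groupPartitions r n ↔ (∃ N, (∀ i, N ≤ i → Subsingleton (P i).Rep) ∧
      ∏ i ∈ Finset.range N, (P i).order = n) ∧ (∀ i, (P i).Contains (P (i + 1))) ∧
      FinAbClass.AtMostFactors P r := by
  constructor
  · rintro ⟨⟨G, hG, ⟨e⟩, hP⟩, hr⟩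
    have : Finite (DirectSum ℕ fun i => (P i).Rep) := Finite.of_equiv _ e.toEquiv
    obtain ⟨N, hN⟩ := finite_setOf_nontrivial_of_finite_directSum fun i => (P i).Rep
    refine ⟨⟨N, hN, ?_⟩, hP, hr⟩
    rw [← FinAbClass.prod_order_eq_card_directSum P hN, ← Nat.card_congr e.toEquiv]
    exact hG
  · rintro ⟨⟨N, hN, hn⟩, hP, hr⟩
    have : Finite (DirectSum ℕ fun i => (P i).Rep) :=
      Finite.of_injective _ (bijective_directSum_restrict _ hN).1
    obtain ⟨e⟩ := FinAbClass.exists_addEquiv ⟨DirectSum ℕ fun i => (P i).Rep⟩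
    refine ⟨⟨Quotient.mk _ ⟨DirectSum ℕ fun i => (P i).Rep⟩, ?_, ⟨e⟩, hP⟩, hr⟩
    exact (Nat.card_congr e.toEquiv).trans
      ((FinAbClass.prod_order_eq_card_directSum P hN).trans hn)

/-- A sequence determines the class of its direct sum, so the sets counted for different `G` are the
fibres of a map on `groupPartitions r n`. -/
theorem groupPartitionCount_eq_ncard {r : ℕ∞} {n : ℕ} (hfin : (groupPartitions r n).Finite) :
    groupPartitionCount r n = (groupPartitions r n).ncard := by
  classical
  have key : ∀ P ∈ groupPartitions r n,
      ∃ G : FinAbClass, G.order = n ∧ FinAbClass.IsGroupPartition P G := fun P hP => hP.1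
  have : Nonempty FinAbClass := ⟨Quotient.mk _ ⟨PUnit⟩⟩
  choose! Φ hΦ using key
  have uniq : ∀ P ∈ groupPartitions r n, ∀ G, FinAbClass.IsGroupPartition P G → Φ P = G := by
    rintro P hP G ⟨⟨e⟩, -⟩
    obtain ⟨-, ⟨⟨e'⟩, -⟩⟩ := hΦ P hP
    exact FinAbClass.eq_of_addEquiv (e'.trans e.symm)
  have hfib : ∀ G : FinAbClass, G.order = n →
      {P : ℕ → FinAbClass | FinAbClass.IsGroupPartition P G ∧ FinAbClass.AtMostFactors P r} =
        (hfin.toFinset.filter fun P => Φ P = G : Finset (ℕ → FinAbClass)) := by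
    intro G hG
    ext P
    simp only [Set.mem_ofPred_eq, Finset.coe_filter, Set.Finite.mem_toFinset]
    constructor
    · rintro ⟨h1, h2⟩
      have hP : P ∈ groupPartitions r n := ⟨⟨G, hG, h1⟩, h2⟩
      exact ⟨hP, uniq P hP G h1⟩
    · rintro ⟨hP, rfl⟩
      exact ⟨(hΦ P hP).2, hP.2⟩
  rw [Set.ncard_eq_toFinset_card _ hfin, Finset.card_eq_sum_card_fiberwise
    (t := hfin.toFinset.image Φ) (fun P hP => Finset.mem_image_of_mem Φ hP)]
  unfold groupPartitionCount
  -- `finsum` would be zero on an infinite support; here the support lies in the image of a finite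
  -- set.
  refine (finsum_mem_eq_sum_of_subset (s := {G : FinAbClass | G.order = n})
    (t := hfin.toFinset.image Φ) _ ?_ ?_).trans ?_
  · rintro G ⟨hG, hG'⟩
    rw [Function.mem_support, FinAbClass.numPartitions, hfib G hG, Set.ncard_coe_finset,
      Finset.card_ne_zero] at hG'
    obtain ⟨P, hP⟩ := hG'
    rw [Finset.mem_filter] at hP
    exact Finset.mem_coe.2 (Finset.mem_image.2 ⟨P, hP⟩)
  · intro G hG
    obtain ⟨P, hP, rfl⟩ := Finset.mem_image.1 (Finset.mem_coe.1 hG)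
    exact (hΦ P (hfin.mem_toFinset.1 hP)).1
  · refine Finset.sum_congr rfl fun G hG => ?_
    obtain ⟨P, hP, rfl⟩ := Finset.mem_image.1 hG
    rw [FinAbClass.numPartitions, hfib _ (hΦ P (hfin.mem_toFinset.1 hP)).1, Set.ncard_coe_finset]

theorem Finsupp.degree_eq_sum_box (π : ℕ × ℕ →₀ ℕ) {B N : ℕ} (h1 : ∀ a i, B ≤ a → π (a, i) = 0)
    (h2 : ∀ a i, N ≤ i → π (a, i) = 0) :
    π.degree = ∑ i ∈ Finset.range N, ∑ a ∈ Finset.range B, π (a, i) := by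
  rw [← Finset.sum_product_right, Finsupp.degree_apply]
  refine Finset.sum_subset ?_ fun c _ hc => by simpa using hc
  rintro ⟨a, i⟩ hc
  rw [Finsupp.mem_support_iff] at hc
  simp only [Finset.mem_product, Finset.mem_range]
  by_contra h'
  by_cases ha : B ≤ a
  · exact hc (h1 a i ha)
  · exact hc (h2 a i (by omega))

theorem PlanePartitions.eq_zero_of_le {r : ℕ∞} {n : ℕ} (π : PlanePartitions r n) {c : ℕ × ℕ}
    (h : n ≤ c.1 ∨ n ≤ c.2) : π.1 c = 0 := by
  by_contra h'
  have := lt_degree_of_antitone π.2.1 h'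
  rw [π.2.2.2] at this
  omega

/-- The plane partition at `p` attached to a group-partition. -/
noncomputable def planePartitionAt {r : ℕ∞} {n : ℕ} (hn : n ≠ 0) (P : groupPartitions r n)
    (p : Nat.Primes) : PlanePartitions r (n.factorization p) := by
  have hP := mem_groupPartitions_iff.1 P.2
  have hle : ∀ i, (P.1 i).order.factorization p ≤ n.factorization p := by
    obtain ⟨⟨N, hN, hprod⟩, -⟩ := hP
    intro i
    by_cases hi : i < N
    · refine (Nat.factorization_le_iff_dvd (P.1 i).order_ne_zero hn).2 ?_ p
      exact (Finset.dvd_prod_of_mem (fun i => (P.1 i).order) (Finset.mem_range.2 hi)).trans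
        hprod.dvd
    · rw [((P.1 i).order_eq_one_iff).2 (hN i (not_lt.1 hi))]
      simp
  have hfin : (Function.support fun c : ℕ × ℕ => primaryRank p.1 c.1 (P.1 c.2).Rep).Finite := by
    obtain ⟨⟨N, hN, hprod⟩, -⟩ := hP
    refine (Finset.range (n.factorization p) ×ˢ Finset.range N).finite_toSet.subset fun c hc => ?_
    rw [Finset.mem_coe, Finset.mem_product, Finset.mem_range, Finset.mem_range]
    constructor
    · by_contra h
      exact hc (primaryRank_eq_zero p.2 ((hle c.2).trans (not_lt.1 h)))
    · by_contra h
      exact hc (((P.1 c.2).subsingleton_iff).1 (hN c.2 (not_lt.1 h)) p c.1)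
  refine ⟨Finsupp.ofSupportFinite _ hfin, ?_, ?_, ?_⟩
  · exact antitone_prod_nat (fun a i => primaryRank_succ_le p.1 a)
      fun a i => ((P.1 i).contains_iff _).1 (hP.2.1 i) p a
  · intro c hc
    exact ((P.1 c.2).subsingleton_iff).1 (hP.2.2 c.2 hc) p c.1
  · obtain ⟨⟨N, hN, hprod⟩, -⟩ := hP
    rw [Finsupp.degree_eq_sum_box _ (B := n.factorization p) (N := N)
      (fun a i h => primaryRank_eq_zero p.2 ((hle i).trans h))
      (fun a i h => ((P.1 i).subsingleton_iff).1 (hN i h) p a)]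
    conv_rhs => rw [← hprod, Nat.factorization_prod fun i _ => (P.1 i).order_ne_zero,
      Finsupp.finsetSum_apply]
    exact Finset.sum_congr rfl fun i _ => ((P.1 i).factorization_order p (hle i)).symm

theorem planePartitionAt_apply {r : ℕ∞} {n : ℕ} (hn : n ≠ 0) (P : groupPartitions r n)
    (p : Nat.Primes) (a i : ℕ) :
    (planePartitionAt hn P p).1 (a, i) = primaryRank p.1 a (P.1 i).Rep := rfl

/-- Injectivity holds because ranks determine a class. For surjectivity, the given partitions are
empty at primes above `n` and confined to an `n × n` box, so each index `i` can be realised by a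
finite group. -/
theorem planePartitionAt_bijective {r : ℕ∞} {n : ℕ} (hn : n ≠ 0) :
    Function.Bijective (planePartitionAt (r := r) hn) := by
  constructor
  · intro P Q h
    refine Subtype.ext (funext fun i => FinAbClass.ext_primaryRank fun p a => ?_)
    rw [← planePartitionAt_apply hn P, ← planePartitionAt_apply hn Q, h]
  · intro π
    have hfac : ∀ p, n.factorization p ≤ n := fun p =>
      (Nat.factorization_lt p hn).le
    have hπ : ∀ (p : Nat.Primes) (c : ℕ × ℕ), n < p.1 ∨ n ≤ c.1 ∨ n ≤ c.2 → (π p).1 c = 0 := by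
      rintro p c (h | h)
      · refine (π p).eq_zero_of_le (Or.inl ?_)
        rw [Nat.factorization_eq_zero_of_lt h]
        exact Nat.zero_le _
      · exact (π p).eq_zero_of_le (h.imp (hfac p).trans (hfac p).trans)
    choose A hA using fun i => exists_finAb_primaryRank_eq (fun p a => (π p).1 (a, i))
      (fun p a b hab => (π p).2.1 ⟨hab, le_rfl⟩) (n + 1) (fun p hp a => hπ p _ (Or.inl hp))
      (fun p a ha => hπ p _ (Or.inr (Or.inl (Nat.le_of_succ_le ha))))
    let P : ℕ → FinAbClass := fun i => Quotient.mk _ (A i)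
    have hP : ∀ i (p : Nat.Primes) a, primaryRank p.1 a (P i).Rep = (π p).1 (a, i) := by
      intro i p a
      obtain ⟨e⟩ := FinAbClass.exists_addEquiv (A i)
      rw [← hA i p a]
      exact primaryRank_congr e p.1 a
    have hN : ∀ i, n ≤ i → Subsingleton (P i).Rep := fun i hi =>
      ((P i).subsingleton_iff).2 fun p a => by
        rw [hP]
        exact hπ p _ (Or.inr (Or.inr hi))
    have hmem : P ∈ groupPartitions r n := by
      refine mem_groupPartitions_iff.2 ⟨⟨n, hN, ?_⟩, fun i => ?_, fun i hi => ?_⟩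
      · refine Nat.eq_of_factorization_eq (Finset.prod_ne_zero_iff.2
          fun i _ => (P i).order_ne_zero) hn fun p => ?_
        by_cases hp : p.Prime
        · rw [Nat.factorization_prod fun i _ => (P i).order_ne_zero, Finsupp.finsetSum_apply]
          obtain ⟨p, rfl⟩ : ∃ p' : Nat.Primes, p'.1 = p := ⟨⟨p, hp⟩, rfl⟩
          -- The order of `P i` is not yet known to divide `n`, so the range of summation is
          -- enlarged to cover its exponent too; the extra ranks vanish.
          have hB : ∀ i, (P i).order.factorization p ≤ n ⊔ (P i).order.factorization p :=
            fun i => le_sup_right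
          conv_rhs => rw [← (π p).2.2.2]
          rw [Finsupp.degree_eq_sum_box _ (B := n) (N := n)
            (fun a i h => hπ p _ (Or.inr (Or.inl h))) (fun a i h => hπ p _ (Or.inr (Or.inr h)))]
          refine Finset.sum_congr rfl fun i _ => ?_
          rw [(P i).factorization_order p (hB i)]
          simp only [hP]
          refine (Finset.sum_subset (Finset.range_mono le_sup_left) fun a _ ha => ?_).symm
          exact hπ p _ (Or.inr (Or.inl (by simpa using ha)))
        · simp [Nat.factorization_eq_zero_of_not_prime, hp]
      · refine ((P i).contains_iff _).2 fun p a => ?_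
        rw [hP, hP]
        exact (π p).2.1 ⟨le_rfl, Nat.le_succ i⟩
      · refine ((P i).subsingleton_iff).2 fun p a => ?_
        rw [hP]
        exact (π p).2.2.1 _ hi
    refine ⟨⟨P, hmem⟩, funext fun p => Subtype.ext (Finsupp.ext ?_)⟩
    rintro ⟨a, i⟩
    rw [planePartitionAt_apply, hP]

theorem finite_pi_planePartitions (r : ℕ∞) (n : ℕ) :
    Finite (∀ p : Nat.Primes, PlanePartitions r (n.factorization p)) := by
  have : Finite {p : Nat.Primes // p.1 ≤ n} :=
    Finite.of_injective (fun p => (⟨p.1.1, Nat.lt_succ_of_le p.2⟩ : Fin (n + 1))) fun x y h =>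
      Subtype.ext (Subtype.ext (congrArg Fin.val h))
  have : ∀ m, Finite (PlanePartitions r m) := fun m => (planePartitions_equiv_weightedArrays r m).2
  refine Finite.of_injective (fun (f : ∀ p : Nat.Primes, PlanePartitions r (n.factorization p))
    (p : {p : Nat.Primes // p.1 ≤ n}) => f p.1) fun f g h => funext fun p => ?_
  by_cases hp : p.1 ≤ n
  · exact congrFun h ⟨p, hp⟩
  · refine Subtype.ext (Finsupp.ext fun c => ?_)
    have : n.factorization p ≤ c.1 := by
      rw [Nat.factorization_eq_zero_of_lt (not_le.1 hp)]
      exact Nat.zero_le _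
    rw [(f p).eq_zero_of_le (Or.inl this), (g p).eq_zero_of_le (Or.inl this)]

theorem groupPartitionCount_eq_card_pi (r : ℕ∞) {n : ℕ} (hn : n ≠ 0) :
    groupPartitionCount r n =
      Nat.card (∀ p : Nat.Primes, WeightedArrays r (n.factorization p)) ∧
    Finite (∀ p : Nat.Primes, WeightedArrays r (n.factorization p)) := by
  have h1 := finite_pi_planePartitions r n
  let e := Equiv.piCongrRight fun p : Nat.Primes =>
    (planePartitions_equiv_weightedArrays r (n.factorization p)).1.some
  have h2 : Finite (groupPartitions r n) :=
    Finite.of_injective _ (planePartitionAt_bijective hn).1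
  refine ⟨?_, Finite.of_equiv _ e⟩
  rw [groupPartitionCount_eq_ncard (Set.toFinite _), ← Nat.card_coe_set_eq,
    Nat.card_eq_of_bijective _ (planePartitionAt_bijective hn), Nat.card_congr e]

/-! ### Arrays of integers and the Dirichlet quotient by `ζ(s)` -/

/-- The product of the numbers `(g c + 1) ^ (i + l + 1)` over the cells `c = (i, l)`. -/
noncomputable def cellNorm (g : ℕ × ℕ →₀ ℕ) : ℕ := g.prod fun c k => (k + 1) ^ (c.1 + c.2 + 1)

theorem cellNorm_ne_zero (g : ℕ × ℕ →₀ ℕ) : cellNorm g ≠ 0 :=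
  Finset.prod_ne_zero_iff.2 fun _ _ => pow_ne_zero _ (Nat.succ_ne_zero _)

/-- The exponents of the prime `p` in the numbers `g c + 1`. -/
noncomputable def cellExponents (p : ℕ) (g : ℕ × ℕ →₀ ℕ) : ℕ × ℕ →₀ ℕ :=
  g.mapRange (fun k => (k + 1).factorization p) (by simp)

theorem cellExponents_apply (p : ℕ) (g : ℕ × ℕ →₀ ℕ) (c : ℕ × ℕ) :
    cellExponents p g c = (g c + 1).factorization p := by
  simp [cellExponents]

theorem cellWeight_cellExponents (p : ℕ) (g : ℕ × ℕ →₀ ℕ) :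
    cellWeight (cellExponents p g) = (cellNorm g).factorization p := by
  have h1 : (cellExponents p g).support ⊆ g.support := Finsupp.support_mapRange
  rw [cellWeight, cellNorm, Finsupp.sum_of_support_subset _ h1 _ (fun _ _ => mul_zero _),
    Finsupp.prod, Nat.factorization_prod fun c _ => pow_ne_zero _ (Nat.succ_ne_zero _),
    Finsupp.finsetSum_apply]
  refine Finset.sum_congr rfl fun c _ => ?_
  rw [Nat.factorization_pow, cellExponents_apply]
  rfl

/-- Arrays with at most `r` rows and of norm `n`. -/
abbrev NormedArrays (r : ℕ∞) (n : ℕ) : Type :=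
  {g : ℕ × ℕ →₀ ℕ // (∀ c : ℕ × ℕ, r ≤ (c.2 : ℕ∞) → g c = 0) ∧ cellNorm g = n}

/-- Unique factorization of the integers `g c + 1` at all cells simultaneously. The shift by one
makes the trivial factor `1` correspond to the value zero, so that arrays are finitely supported. -/
theorem normedArrays_equiv (r : ℕ∞) {n : ℕ} (hn : n ≠ 0) :
    Nonempty (NormedArrays r n ≃ ∀ p : Nat.Primes, WeightedArrays r (n.factorization p)) := by
  refine ⟨Equiv.ofBijective (fun g p => ⟨cellExponents p g.1, fun c hc => by
    rw [cellExponents_apply, g.2.1 c hc]; simp, by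
    rw [cellWeight_cellExponents, g.2.2]⟩) ⟨?_, ?_⟩⟩
  · intro g h hgh
    refine Subtype.ext (Finsupp.ext fun c => Nat.succ_injective ?_)
    refine Nat.eq_of_factorization_eq (Nat.succ_ne_zero _) (Nat.succ_ne_zero _) fun p => ?_
    by_cases hp : p.Prime
    · have h1 := DFunLike.congr_fun (congrArg Subtype.val (congrFun hgh ⟨p, hp⟩)) c
      simpa only [cellExponents_apply] using h1
    · simp [Nat.factorization_eq_zero_of_not_prime, hp]
  · intro E
    have hE : ∀ (p : Nat.Primes) c, (E p).1 c ≠ 0 → p.1 ≤ n ∧ c.1 + c.2 + 1 ≤ n := by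
      intro p c h
      have h1 := le_cellWeight h
      rw [(E p).2.2] at h1
      refine ⟨?_, h1.trans (Nat.factorization_lt p hn).le⟩
      by_contra h2
      rw [Nat.factorization_eq_zero_of_lt (not_le.1 h2)] at h1
      omega
    let f : ℕ × ℕ → ℕ →₀ ℕ := fun c => Finsupp.onFinset (Finset.range (n + 1))
      (fun p => if h : p.Prime then (E ⟨p, h⟩).1 c else 0) fun p hp => by
        by_cases h : p.Prime
        · rw [dif_pos h] at hp
          exact Finset.mem_range.2 (Nat.lt_succ_of_le (hE _ c hp).1)
        · exact (hp (dif_neg h)).elim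
    have hf : ∀ c, ∀ p ∈ (f c).support, p.Prime := fun c p hp => by
      by_contra h
      exact Finsupp.mem_support_iff.1 hp (dif_neg h)
    have hf' : ∀ c (p : Nat.Primes), f c p = (E p).1 c := fun c p => dif_pos p.2
    let m : ℕ × ℕ → ℕ := fun c => (f c).prod (· ^ ·)
    have hm : ∀ c, (m c).factorization = f c := fun c => Nat.prod_pow_factorization_eq_self (hf c)
    have hm0 : ∀ c, m c ≠ 0 := fun c =>
      Finset.prod_ne_zero_iff.2 fun p hp => pow_ne_zero _ (hf c p hp).ne_zero
    have hm1 : ∀ c, (∀ p, (E p).1 c = 0) → m c = 1 := fun c hc => by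
      have : f c = 0 := by
        ext p
        by_cases h : p.Prime
        · exact (hf' c ⟨p, h⟩).trans (hc _)
        · exact dif_neg h
      simp [m, this]
    let g : ℕ × ℕ →₀ ℕ := Finsupp.onFinset (Finset.range n ×ˢ Finset.range n)
      (fun c => m c - 1) fun c hc => by
        by_contra h
        refine hc ?_
        refine Nat.sub_eq_zero_of_le (hm1 c fun p => ?_).le
        by_contra h'
        have := (hE p c h').2
        simp only [Finset.mem_product, Finset.mem_range] at h
        omega
    have hg : ∀ c, g c + 1 = m c := fun c => Nat.succ_pred_eq_of_pos (Nat.pos_of_ne_zero (hm0 c))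
    have hexp : ∀ p : Nat.Primes, cellExponents p g = (E p).1 := fun p => by
      ext c
      rw [cellExponents_apply, hg, hm, hf']
    refine ⟨⟨g, fun c hc => ?_, ?_⟩, funext fun p => Subtype.ext (hexp p)⟩
    · have := hg c
      rw [hm1 c fun p => (E p).2.1 c hc] at this
      omega
    · refine Nat.eq_of_factorization_eq (cellNorm_ne_zero g) hn fun p => ?_
      by_cases hp : p.Prime
      · rw [← cellWeight_cellExponents, hexp ⟨p, hp⟩, (E ⟨p, hp⟩).2.2]
      · simp [Nat.factorization_eq_zero_of_not_prime, hp]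

theorem groupPartitionCount_eq_card_normedArrays (r : ℕ∞) {n : ℕ} (hn : n ≠ 0) :
    groupPartitionCount r n = Nat.card (NormedArrays r n) ∧ Finite (NormedArrays r n) := by
  obtain ⟨e⟩ := normedArrays_equiv r hn
  obtain ⟨h1, h2⟩ := groupPartitionCount_eq_card_pi r hn
  exact ⟨h1.trans (Nat.card_congr e.symm), Finite.of_equiv _ e.symm⟩

/-- Arrays with at most `r` rows of norm `n` which vanish at the origin. -/
abbrev ReducedArrays (r : ℕ∞) (n : ℕ) : Type :=
  {g : ℕ × ℕ →₀ ℕ // ((∀ c : ℕ × ℕ, r ≤ (c.2 : ℕ∞) → g c = 0) ∧ g (0, 0) = 0) ∧ cellNorm g = n}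

theorem finite_reducedArrays (r : ℕ∞) (n : ℕ) : Finite (ReducedArrays r n) := by
  by_cases hn : n = 0
  · have : IsEmpty (ReducedArrays r n) := ⟨fun g => cellNorm_ne_zero g.1 (g.2.2.trans hn)⟩
    infer_instance
  · have := (groupPartitionCount_eq_card_normedArrays r hn).2
    exact Finite.of_injective
      (fun g : ReducedArrays r n => (⟨g.1, g.2.1.1, g.2.2⟩ : NormedArrays r n))
      fun x y h => Subtype.ext (congrArg (fun z => z.1) h)

/-- The Dirichlet quotient of `groupPartitionCount r` by the constant function one. -/
noncomputable def reducedCount (r : ℕ∞) (n : ℕ) : ℕ := Nat.card (ReducedArrays r n)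

theorem mul_cellNorm_erase (g : ℕ × ℕ →₀ ℕ) :
    (g (0, 0) + 1) * cellNorm (g.erase (0, 0)) = cellNorm g := by
  have := Finsupp.mul_prod_erase' g (0, 0)
    (fun (c : ℕ × ℕ) k => (k + 1) ^ (c.1 + c.2 + 1)) fun i => by simp
  simpa [cellNorm] using this

/-- The origin is the only cell with exponent one, so its entry is the cofactor of the norm of the
remaining array. As `r ≥ 1`, the row condition leaves this entry free. -/
theorem groupPartitionCount_eq_sum_divisors {r : ℕ∞} (hr : 1 ≤ r) {n : ℕ} (hn : n ≠ 0) :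
    groupPartitionCount r n = ∑ d ∈ n.divisors, reducedCount r d := by
  have hfin := (groupPartitionCount_eq_card_normedArrays r hn).2
  rw [(groupPartitionCount_eq_card_normedArrays r hn).1]
  let Φ : NormedArrays r n → n.divisors := fun g => ⟨cellNorm (g.1.erase (0, 0)),
    Nat.mem_divisors.2 ⟨⟨_, by rw [mul_comm, mul_cellNorm_erase]; exact g.2.2.symm⟩, hn⟩⟩
  have e : ∀ d : n.divisors, Nonempty ({g // Φ g = d} ≃ ReducedArrays r d) := by
    intro d
    obtain ⟨k, hk⟩ := (Nat.mem_divisors.1 d.2).1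
    have hd : d.1 ≠ 0 := fun h => hn (by rw [hk, h, zero_mul])
    have hk0 : k ≠ 0 := fun h => hn (by rw [hk, h, mul_zero])
    have herase : ∀ g : ReducedArrays r d.1,
        (g.1.update (0, 0) (k - 1)).erase (0, 0) = g.1 := fun g => by
      ext c
      by_cases hc : c = (0, 0)
      · subst hc; simp [g.2.1.2]
      · simp [hc]
    exact ⟨
      { toFun := fun g => ⟨g.1.1.erase (0, 0), ⟨fun c hc => by
          by_cases h : c = (0, 0)
          · simp [h]
          · rw [Finsupp.erase_ne h]; exact g.1.2.1 c hc, by simp⟩, congrArg Subtype.val g.2⟩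
        invFun := fun g => ⟨⟨g.1.update (0, 0) (k - 1), fun c hc => by
          have h : c ≠ (0, 0) := by
            rintro rfl
            exact absurd (hr.trans hc) (by simp)
          simp [Function.update_of_ne h, g.2.1.1 c hc], by
          rw [← mul_cellNorm_erase, herase, g.2.2]
          simp only [Finsupp.coe_update, Function.update_self]
          rw [Nat.sub_add_cancel (Nat.pos_of_ne_zero hk0), mul_comm]
          exact hk.symm⟩, Subtype.ext (by
          change cellNorm ((g.1.update (0, 0) (k - 1)).erase (0, 0)) = _
          rw [herase, g.2.2])⟩
        left_inv := fun g => by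
          refine Subtype.ext (Subtype.ext ?_)
          have h1 := mul_cellNorm_erase g.1.1
          have h2 : cellNorm (g.1.1.erase (0, 0)) = d.1 := congrArg Subtype.val g.2
          rw [h2, g.1.2.2, mul_comm] at h1
          have h3 := Nat.eq_of_mul_eq_mul_left (Nat.pos_of_ne_zero hd) (h1.trans hk)
          ext c
          by_cases hc : c = (0, 0)
          · subst hc; simp [← h3]
          · simp [hc]
        right_inv := fun g => Subtype.ext (herase g) }⟩
  rw [← Nat.card_congr (Equiv.sigmaFiberEquiv Φ), Nat.card_sigma]
  simp only [Nat.card_congr (e _).some]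
  exact Finset.sum_coe_sort n.divisors fun d => reducedCount r d

theorem tsum_reducedCount_mul (r : ℕ∞) (F : ℕ → ℝ≥0∞) :
    ∑' d, (reducedCount r d : ℝ≥0∞) * F d =
      ∑' g : {g : ℕ × ℕ →₀ ℕ // (∀ c : ℕ × ℕ, r ≤ (c.2 : ℕ∞) → g c = 0) ∧ g (0, 0) = 0},
        F (cellNorm g.1) := by
  rw [← (Equiv.sigmaFiberEquiv fun g : {g : ℕ × ℕ →₀ ℕ //
    (∀ c : ℕ × ℕ, r ≤ (c.2 : ℕ∞) → g c = 0) ∧ g (0, 0) = 0} => cellNorm g.1).tsum_eq,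
    ENNReal.tsum_sigma']
  refine tsum_congr fun d => ?_
  have := finite_reducedArrays r d
  have e := (Equiv.subtypeSubtypeEquivSubtypeInter (fun g : ℕ × ℕ →₀ ℕ =>
    (∀ c : ℕ × ℕ, r ≤ (c.2 : ℕ∞) → g c = 0) ∧ g (0, 0) = 0) fun g => cellNorm g = d)
  have hfin := Finite.of_equiv _ e.symm
  have := Fintype.ofFinite {g : {g : ℕ × ℕ →₀ ℕ //
    (∀ c : ℕ × ℕ, r ≤ (c.2 : ℕ∞) → g c = 0) ∧ g (0, 0) = 0} // cellNorm g.1 = d}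
  rw [tsum_fintype, reducedCount, ← Nat.card_congr e, Finset.sum_congr rfl (fun g _ => by
    rw [show cellNorm ((Equiv.sigmaFiberEquiv _) ⟨d, g⟩).1 = d from g.2])]
  simp

open scoped Classical in
/-- The sum over all reduced arrays of a completely multiplicative function of the norm. -/
theorem tsum_reducedCount_mul_eq_iSup (r : ℕ∞) (F : ℕ →* ℝ≥0∞) :
    ∑' d, (reducedCount r d : ℝ≥0∞) * F d =
      ⨆ s : Finset (ℕ × ℕ), ∏ c ∈ s, if c = (0, 0) ∨ r ≤ (c.2 : ℕ∞) then 1 else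
        ∑' k, F (k + 1) ^ (c.1 + c.2 + 1) := by
  -- At the origin and in the forbidden rows only the entry zero is allowed, so those cells
  -- contribute the factor `1`.
  let G : ℕ × ℕ → ℕ → ℝ≥0∞ := fun c k => if c = (0, 0) ∨ r ≤ (c.2 : ℕ∞) then
    (if k = 0 then 1 else 0) else F (k + 1) ^ (c.1 + c.2 + 1)
  have hG : ∀ c, G c 0 = 1 := fun c => by simp [G]
  rw [tsum_reducedCount_mul]
  have h1 : (fun s : Finset (ℕ × ℕ) => ∏ c ∈ s, if c = (0, 0) ∨ r ≤ (c.2 : ℕ∞) then 1 else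
        ∑' k, F (k + 1) ^ (c.1 + c.2 + 1)) = fun s => ∏ c ∈ s, ∑' k, G c k := by
    funext s
    refine Finset.prod_congr rfl fun c _ => ?_
    by_cases h : c = (0, 0) ∨ r ≤ (c.2 : ℕ∞) <;> simp [G, h]
  rw [h1, ← tsum_finsupp_prod G hG]
  refine (tsum_subtype {g : ℕ × ℕ →₀ ℕ | (∀ c : ℕ × ℕ, r ≤ (c.2 : ℕ∞) → g c = 0) ∧
    g (0, 0) = 0} fun g => F (cellNorm g)).trans (tsum_congr fun g => ?_)
  by_cases hg : (∀ c : ℕ × ℕ, r ≤ (c.2 : ℕ∞) → g c = 0) ∧ g (0, 0) = 0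
  · refine (Set.indicator_of_mem (s := {g : ℕ × ℕ →₀ ℕ | (∀ c : ℕ × ℕ, r ≤ (c.2 : ℕ∞) → g c = 0) ∧
      g (0, 0) = 0}) hg _).trans ?_
    rw [cellNorm, Finsupp.prod, map_prod]
    refine Finset.prod_congr rfl fun c hc => ?_
    have : ¬ (c = (0, 0) ∨ r ≤ (c.2 : ℕ∞)) := by
      rintro (h | h)
      · exact Finsupp.mem_support_iff.1 hc (h ▸ hg.2)
      · exact Finsupp.mem_support_iff.1 hc (hg.1 c h)
    simp only [G, if_neg this, map_pow]
  · refine (Set.indicator_of_notMem (s := {g : ℕ × ℕ →₀ ℕ | (∀ c : ℕ × ℕ, r ≤ (c.2 : ℕ∞) → g c = 0) ∧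
      g (0, 0) = 0}) hg _).trans ?_
    obtain ⟨c, hc, hgc⟩ : ∃ c : ℕ × ℕ, (c = (0, 0) ∨ r ≤ (c.2 : ℕ∞)) ∧ g c ≠ 0 := by
      by_contra! h
      exact hg ⟨fun c hc => h c (Or.inr hc), h _ (Or.inl rfl)⟩
    exact (Finset.prod_eq_zero (Finsupp.mem_support_iff.2 hgc) (by simp [G, hc, hgc])).symm

/-! ### Zeta values, convergence of the products and the constant -/

/-- The value at `m` of the zeta function without the Euler factors at the primes dividing `j`. -/
noncomputable def zetaAway (j m : ℕ) : ℝ :=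
  (riemannZeta (m : ℂ)).re * ∏ p ∈ j.primeFactors, (1 - ((p : ℝ) ^ m)⁻¹)

/-- The series is the L-series of the trivial character modulo `j`. -/
theorem hasSum_zetaAway {j : ℕ} (hj : j ≠ 0) {m : ℕ} (hm : 2 ≤ m) :
    HasSum (fun k : ℕ => if (k + 1).Coprime j then (((k + 1 : ℕ) : ℝ) ^ m)⁻¹ else 0)
      (zetaAway j m) := by
  have : NeZero j := ⟨hj⟩
  have hs : 1 < (m : ℂ).re := by
    rw [Complex.natCast_re]
    exact_mod_cast hm
  have hs1 : (m : ℂ) ≠ 1 := by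
    exact_mod_cast (show m ≠ 1 by omega)
  have h1 := (DirichletCharacter.LSeriesSummable_of_one_lt_re
    (1 : DirichletCharacter ℂ j) hs).hasSum
  have h2 := DirichletCharacter.LFunctionTrivChar_eq_mul_riemannZeta (N := j) hs1
  rw [DirichletCharacter.LFunctionTrivChar, DirichletCharacter.LFunction_eq_LSeries _ hs,
    LSeries] at h2
  rw [h2] at h1
  have h3 := (hasSum_nat_add_iff' 1).2 h1
  simp only [Finset.range_one, Finset.sum_singleton, LSeries.term_zero, sub_zero] at h3
  have h4 := Complex.hasSum_re h3
  have h5 : (∏ p ∈ j.primeFactors, (1 - (p : ℂ) ^ (-(m : ℂ)))) =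
      ((∏ p ∈ j.primeFactors, (1 - ((p : ℝ) ^ m)⁻¹) : ℝ) : ℂ) := by
    push_cast
    refine Finset.prod_congr rfl fun p _ => ?_
    rw [Complex.cpow_neg, Complex.cpow_natCast]
  rw [h5, Complex.re_ofReal_mul, mul_comm] at h4
  rw [zetaAway]
  convert h4 using 2 with k
  rw [LSeries.term_of_ne_zero (Nat.succ_ne_zero k), Complex.cpow_natCast]
  split_ifs with hk
  · rw [MulChar.one_apply ((ZMod.isUnit_iff_coprime _ _).2 hk), one_div, ← Complex.ofReal_natCast,
      ← Complex.ofReal_pow, ← Complex.ofReal_inv, Complex.ofReal_re]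
  · rw [MulChar.map_nonunit _ fun h => hk ((ZMod.isUnit_iff_coprime _ _).1 h), zero_div,
      Complex.zero_re]

/-- Writing `(k + 2) ^ (-m)` as `(2 / (k + 2)) ^ m * 2 ^ (-m)` and lowering the first exponent to
`2` leaves a constant independent of `m`. The decay `2 ^ (-m)` beats the exponent `min(m, r) ≤ m`.
-/
theorem zeta_tail_le {m : ℕ} (hm : 2 ≤ m) :
    1 ≤ (riemannZeta (m : ℂ)).re ∧
      (riemannZeta (m : ℂ)).re - 1 ≤ (∑' k : ℕ, ((2 : ℝ) / (k + 2)) ^ 2) * (1 / 2) ^ m := by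
  have h := hasSum_zetaAway one_ne_zero hm
  have h0 : zetaAway 1 m = (riemannZeta (m : ℂ)).re := by simp [zetaAway]
  simp only [Nat.coprime_one_right_eq_true, if_true, h0] at h
  have h1 := (hasSum_nat_add_iff' 1).2 h
  simp only [Finset.range_one, Finset.sum_singleton, zero_add, Nat.cast_one, one_pow,
    inv_one] at h1
  have hsum : Summable fun k : ℕ => ((2 : ℝ) / (k + 2)) ^ 2 := by
    have := ((summable_nat_add_iff 2).2 (Real.summable_one_div_nat_pow.2 one_lt_two)).mul_left 4
    refine this.congr fun k => ?_
    rw [div_pow]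
    push_cast
    ring
  refine ⟨?_, ?_⟩
  · have := h1.nonneg fun k => by positivity
    linarith
  · rw [← tsum_mul_right]
    refine hasSum_le (fun k => ?_) h1 (hsum.mul_right _).hasSum
    have h2 : (0 : ℝ) < k + 2 := by positivity
    have h3 : (2 : ℝ) / (k + 2) ≤ 1 := by
      rw [div_le_one h2]
      linarith [Nat.cast_nonneg (α := ℝ) k]
    calc (((k + 1 + 1 : ℕ) : ℝ) ^ m)⁻¹ = ((2 : ℝ) / (k + 2)) ^ m * (1 / 2) ^ m := by
          rw [← mul_pow, ← inv_pow]
          push_cast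
          congr 1
          field_simp
          ring
      _ ≤ _ := by
          refine mul_le_mul_of_nonneg_right ?_ (by positivity)
          exact pow_le_pow_of_le_one (by positivity) h3 hm

theorem minExp_le (m : ℕ) (r : ℕ∞) : minExp m r ≤ m := by
  have h : min (m : ℕ∞) r ≤ m := min_le_left _ _
  exact (ENat.toNat_le_toNat h (ENat.natCast_ne_top m)).trans (by simp)

theorem summable_nat_mul_half_pow : Summable fun m : ℕ => (m : ℝ) * (1 / 2) ^ m := by
  simpa using summable_pow_mul_geometric_of_norm_lt_one (R := ℝ) 1
    (r := 1 / 2) (by rw [Real.norm_eq_abs, abs_of_pos] <;> norm_num)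

theorem one_le_zetaFactor (r : ℕ∞) {m : ℕ} (hm : 2 ≤ m) : 1 ≤ zetaFactor r m :=
  one_le_pow₀ (zeta_tail_le hm).1

theorem summable_log_zetaFactor (r : ℕ∞) : Summable fun i : ℕ => Real.log (zetaFactor r (i + 2)) := by
  set C := ∑' k : ℕ, ((2 : ℝ) / (k + 2)) ^ 2
  refine Summable.of_nonneg_of_le (fun i => Real.log_nonneg (one_le_zetaFactor r (by omega)))
    (fun i => ?_) (((summable_nat_add_iff 2).2 summable_nat_mul_half_pow).mul_left C)
  obtain ⟨h1, h2⟩ := zeta_tail_le (m := i + 2) (by omega)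
  have h3 := Real.log_le_sub_one_of_pos (x := (riemannZeta ((i + 2 : ℕ) : ℂ)).re) (by linarith)
  have h4 := Real.log_nonneg h1
  rw [zetaFactor, Real.log_pow]
  calc (minExp (i + 2) r : ℝ) * Real.log (riemannZeta ((i + 2 : ℕ) : ℂ)).re
      ≤ ((i + 2 : ℕ) : ℝ) * (C * (1 / 2) ^ (i + 2)) :=
        mul_le_mul (by exact_mod_cast minExp_le _ _) (h3.trans h2) h4 (by positivity)
    _ = _ := by ring

theorem inv_prime_pow_le {p m : ℕ} (hp : p.Prime) : ((p : ℝ) ^ m)⁻¹ ≤ (1 / 2) ^ m := by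
  rw [one_div, inv_pow]
  have : (2 : ℝ) ≤ p := by exact_mod_cast hp.two_le
  gcongr

theorem one_sub_inv_prime_pow {p : ℕ} (hp : p.Prime) (i : ℕ) :
    1 / 2 ≤ 1 - ((p : ℝ) ^ (i + 1))⁻¹ ∧ 1 - ((p : ℝ) ^ (i + 1))⁻¹ ≤ 1 := by
  have h1 := inv_prime_pow_le (m := i + 1) hp
  have h2 : (1 / 2 : ℝ) ^ (i + 1) ≤ 1 / 2 :=
    pow_le_of_le_one (by norm_num) (by norm_num) (by omega)
  have h3 : (0 : ℝ) ≤ ((p : ℝ) ^ (i + 1))⁻¹ := by positivity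
  constructor <;> linarith

theorem localFactor_pos (r : ℕ∞) (j i : ℕ) : 0 < localFactor r j (i + 1) :=
  Finset.prod_pos fun p hp => pow_pos (by
    linarith [(one_sub_inv_prime_pow (Nat.prime_of_mem_primeFactors hp) i).1]) _

theorem summable_log_localFactor (r : ℕ∞) (j : ℕ) :
    Summable fun i : ℕ => Real.log (localFactor r j (i + 1)) := by
  have h : ∀ i, Real.log (localFactor r j (i + 1)) = ∑ p ∈ j.primeFactors,
      (minExp (i + 1) r : ℝ) * Real.log (1 - ((p : ℝ) ^ (i + 1))⁻¹) := by
    intro i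
    rw [localFactor, Real.log_prod fun p hp => (pow_pos (by
      linarith [(one_sub_inv_prime_pow (Nat.prime_of_mem_primeFactors hp) i).1]) _).ne']
    exact Finset.sum_congr rfl fun p _ => Real.log_pow _ _
  simp only [h]
  refine summable_sum fun p hp => ?_
  have hp := Nat.prime_of_mem_primeFactors hp
  refine Summable.of_norm_bounded
    (((summable_nat_add_iff 1).2 summable_nat_mul_half_pow).mul_left 2) fun i => ?_
  obtain ⟨h1, h2⟩ := one_sub_inv_prime_pow hp i
  have h3 := Real.one_sub_inv_le_log_of_pos (x := 1 - ((p : ℝ) ^ (i + 1))⁻¹) (by linarith)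
  have h4 := Real.log_nonpos (by linarith) h2
  have h5 := inv_prime_pow_le (m := i + 1) hp
  -- With `t` the inverse prime power, `t ≤ 1 / 2` gives `1 / (1 - t) - 1 = t / (1 - t) ≤ 2 t`.
  have h6 : (1 - ((p : ℝ) ^ (i + 1))⁻¹)⁻¹ - 1 ≤ 2 * ((p : ℝ) ^ (i + 1))⁻¹ := by
    have h7 : (0 : ℝ) ≤ ((p : ℝ) ^ (i + 1))⁻¹ := by positivity
    rw [sub_le_iff_le_add, inv_le_iff_one_le_mul₀ (by linarith)]
    nlinarith
  rw [Real.norm_eq_abs, abs_mul, abs_of_nonpos h4, Nat.abs_cast]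
  calc (minExp (i + 1) r : ℝ) * -Real.log (1 - ((p : ℝ) ^ (i + 1))⁻¹)
      ≤ ((i + 1 : ℕ) : ℝ) * (2 * (1 / 2) ^ (i + 1)) :=
        mul_le_mul (by exact_mod_cast minExp_le _ _) (by linarith) (by linarith) (by positivity)
    _ = _ := by ring

theorem zetaFactor_mul_localFactor (r : ℕ∞) (j m : ℕ) :
    zetaFactor r m * localFactor r j m = zetaAway j m ^ minExp m r := by
  rw [zetaFactor, localFactor, Finset.prod_pow, ← mul_pow, zetaAway]

/-- The completely multiplicative function `n ↦ 1 / n` on the integers prime to `j`. -/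
noncomputable def invCoprime (j : ℕ) : ℕ →* ℝ≥0∞ where
  toFun n := if n.Coprime j then (n : ℝ≥0∞)⁻¹ else 0
  map_one' := by simp
  map_mul' a b := by
    by_cases hab : (a * b).Coprime j
    · obtain ⟨ha, hb⟩ := Nat.coprime_mul_iff_left.1 hab
      rw [if_pos hab, if_pos ha, if_pos hb, Nat.cast_mul,
        ENNReal.mul_inv (Or.inr (ENNReal.natCast_ne_top b)) (Or.inl (ENNReal.natCast_ne_top a))]
    · rw [if_neg hab]
      by_cases ha : a.Coprime j
      · rw [if_neg fun hb => hab (Nat.coprime_mul_iff_left.2 ⟨ha, hb⟩), mul_zero]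
      · rw [if_neg ha, zero_mul]

theorem tsum_invCoprime_pow {j : ℕ} (hj : j ≠ 0) {m : ℕ} (hm : 2 ≤ m) :
    ∑' k, invCoprime j (k + 1) ^ m = ENNReal.ofReal (zetaAway j m) := by
  have h := hasSum_zetaAway hj hm
  rw [← h.tsum_eq, ENNReal.ofReal_tsum_of_nonneg (fun k => by positivity) h.summable]
  refine tsum_congr fun k => ?_
  change (if (k + 1).Coprime j then ((k + 1 : ℕ) : ℝ≥0∞)⁻¹ else 0) ^ m = _
  split_ifs with hk
  · rw [ENNReal.ofReal_inv_of_pos (by positivity), ENNReal.ofReal_pow (by positivity),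
      ENNReal.ofReal_natCast, ENNReal.inv_pow]
  · rw [zero_pow (by omega), ENNReal.ofReal_zero]

/-- This is where the exponent `min(m, r)` arises: cells on one antidiagonal share the same zeta
factor. -/
theorem card_antidiagonal_filter (m : ℕ) (r : ℕ∞) [DecidablePred fun c : ℕ × ℕ => r ≤ (c.2 : ℕ∞)] :
    ((Finset.HasAntidiagonal.antidiagonal m).filter fun c : ℕ × ℕ => ¬ r ≤ (c.2 : ℕ∞)).card =
      minExp (m + 1) r := by
  obtain ⟨R, hR⟩ : ∃ R : ℕ, (R : ℕ∞) = min ((m + 1 : ℕ) : ℕ∞) r :=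
    ⟨_, ENat.natCast_toNat (ne_top_of_le_ne_top (ENat.natCast_ne_top _) (min_le_left _ _))⟩
  have hR' : ∀ l : ℕ, l < R ↔ l < m + 1 ∧ ¬ r ≤ (l : ℕ∞) := fun l => by
    rw [← ENat.natCast_lt_natCast, hR, lt_min_iff, ENat.natCast_lt_natCast, not_le]
  rw [minExp, ← hR, ENat.toNat_natCast, ← Finset.card_range R]
  symm
  refine Finset.card_nbij' (fun l => (m - l, l)) (fun c => c.2) ?_ ?_ ?_ ?_
  · intro l hl
    have := (hR' l).1 (Finset.mem_range.1 hl)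
    simp only [Finset.coe_filter, Finset.HasAntidiagonal.mem_antidiagonal, Set.mem_ofPred_eq]
    exact ⟨by omega, this.2⟩
  · intro c hc
    simp only [Finset.coe_filter, Finset.HasAntidiagonal.mem_antidiagonal, Set.mem_ofPred_eq] at hc
    exact Finset.mem_coe.2 (Finset.mem_range.2 ((hR' _).2 ⟨by dsimp only; omega, hc.2⟩))
  · intro l _
    rfl
  · intro c hc
    simp only [Finset.coe_filter, Finset.HasAntidiagonal.mem_antidiagonal, Set.mem_ofPred_eq] at hc
    exact Prod.ext (by dsimp only; omega) rfl

/-- The constant `∏_{m ≥ 2} (ζ(m) ∏_{p ∣ j} (1 - p ^ (-m))) ^ min(m, r)`. -/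
noncomputable def eulerConst (r : ℕ∞) (j : ℕ) : ℝ :=
  ∏' i : ℕ, zetaFactor r (i + 2) * localFactor r j (i + 2)

theorem multipliable_zetaFactor (r : ℕ∞) : Multipliable fun i : ℕ => zetaFactor r (i + 2) :=
  Real.multipliable_of_summable_log
    (fun i => lt_of_lt_of_le one_pos (one_le_zetaFactor r (by omega))) (summable_log_zetaFactor r)

theorem multipliable_localFactor (r : ℕ∞) (j : ℕ) :
    Multipliable fun i : ℕ => localFactor r j (i + 1) :=
  Real.multipliable_of_summable_log (localFactor_pos r j) (summable_log_localFactor r j)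

theorem multipliable_localFactor_add_two (r : ℕ∞) (j : ℕ) :
    Multipliable fun i : ℕ => localFactor r j (i + 2) := by
  have h := (summable_nat_add_iff (f := fun i => Real.log (localFactor r j (i + 1))) 1).2
    (summable_log_localFactor r j)
  simp only [add_assoc, one_add_one_eq_two] at h
  refine Real.multipliable_of_summable_log (fun i => ?_) h
  have := localFactor_pos r j (i + 1)
  rwa [add_assoc, one_add_one_eq_two] at this

theorem one_le_zetaAway {j : ℕ} (hj : j ≠ 0) {m : ℕ} (hm : 2 ≤ m) : 1 ≤ zetaAway j m := by
  have h := hasSum_zetaAway hj hm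
  have := le_hasSum h 0 fun k _ => by positivity
  simpa using this

theorem tsum_reducedCount_mul_invCoprime (r : ℕ∞) {j : ℕ} (hj : j ≠ 0) :
    ∑' d, (reducedCount r d : ℝ≥0∞) * invCoprime j d = ENNReal.ofReal (eulerConst r j) := by
  classical
  rw [tsum_reducedCount_mul_eq_iSup]
  set G : ℕ × ℕ → ℝ≥0∞ := fun c => if c = (0, 0) ∨ r ≤ (c.2 : ℕ∞) then 1 else
        ∑' k, invCoprime j (k + 1) ^ (c.1 + c.2 + 1) with hG
  have hG1 : ∀ c, 1 ≤ G c := fun c => by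
    by_cases h : c = (0, 0) ∨ r ≤ (c.2 : ℕ∞)
    · simp [hG, h]
    · have : c.1 + c.2 ≠ 0 := fun h' => h (Or.inl (Prod.ext (by dsimp only; omega)
        (by dsimp only; omega)))
      simp only [hG, if_neg h]
      rw [tsum_invCoprime_pow hj (by omega), ENNReal.one_le_ofReal]
      exact one_le_zetaAway hj (by omega)
  have hdiag : ∀ M : ℕ, ∏ c ∈ (Finset.range (M + 1)).biUnion Finset.HasAntidiagonal.antidiagonal, G c =
      ENNReal.ofReal (∏ i ∈ Finset.range M, zetaFactor r (i + 2) * localFactor r j (i + 2)) := by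
    intro M
    rw [Finset.prod_biUnion fun a _ b _ hab => by
      rw [Function.onFun, Finset.disjoint_left]
      intro c hc hc'
      rw [Finset.HasAntidiagonal.mem_antidiagonal] at hc hc'
      exact hab (hc.symm.trans hc')]
    rw [Finset.prod_range_succ', ENNReal.ofReal_prod_of_nonneg fun i _ => by
      rw [zetaFactor_mul_localFactor]
      exact pow_nonneg (zero_le_one.trans (one_le_zetaAway hj (by omega))) _]
    have h0 : ∏ c ∈ Finset.HasAntidiagonal.antidiagonal 0, G c = 1 := by simp [hG]
    rw [h0, mul_one]
    refine Finset.prod_congr rfl fun i _ => ?_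
    rw [zetaFactor_mul_localFactor, ENNReal.ofReal_pow (zero_le_one.trans
      (one_le_zetaAway hj (by omega))), ← card_antidiagonal_filter, ← Finset.prod_const,
      Finset.prod_filter]
    refine Finset.prod_congr rfl fun c hc => ?_
    rw [Finset.HasAntidiagonal.mem_antidiagonal] at hc
    have hc0 : c ≠ (0, 0) := by
      rintro rfl
      simp at hc
    by_cases h : r ≤ (c.2 : ℕ∞)
    · simp [hG, h]
    · simp only [hG, hc0, h, or_false, if_false, not_false_eq_true, if_true]
      rw [tsum_invCoprime_pow hj (by omega), hc]
  have hmono : ∀ s t : Finset (ℕ × ℕ), s ⊆ t → ∏ c ∈ s, G c ≤ ∏ c ∈ t, G c := fun s t h =>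
    Finset.prod_le_prod_of_subset_of_one_le' h fun c _ _ => hG1 c
  -- All factors are at least `1`, so the supremum over finite sets may be taken along the
  -- exhaustion by antidiagonals, which yields the product ordered by `m`.
  have hsup : ⨆ s : Finset (ℕ × ℕ), ∏ c ∈ s, G c =
      ⨆ M : ℕ, ∏ c ∈ (Finset.range (M + 1)).biUnion Finset.HasAntidiagonal.antidiagonal, G c := by
    refine le_antisymm (iSup_le fun s => ?_) (iSup_le fun M => le_iSup_of_le _ le_rfl)
    refine le_iSup_of_le (s.sup fun c => c.1 + c.2) (hmono _ _ fun c hc => ?_)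
    refine Finset.mem_biUnion.2 ⟨c.1 + c.2, Finset.mem_range.2 (Nat.lt_succ_of_le
      (Finset.le_sup (f := fun c : ℕ × ℕ => c.1 + c.2) hc)), Finset.HasAntidiagonal.mem_antidiagonal.2 rfl⟩
  rw [hsup]
  refine iSup_eq_of_tendsto (fun M N h => hmono _ _
    (Finset.biUnion_subset_biUnion_of_subset_left _ (Finset.range_mono (by omega)))) ?_
  simp only [hdiag]
  exact (ENNReal.continuous_ofReal.tendsto _).comp
    (((multipliable_zetaFactor r).mul
      (multipliable_localFactor_add_two r j)).hasProd.tendsto_prod_nat)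

theorem hasSum_reducedCount_div (r : ℕ∞) {j : ℕ} (hj : j ≠ 0) :
    HasSum (fun d : ℕ => if d.Coprime j then (reducedCount r d : ℝ) / d else 0)
      (eulerConst r j) := by
  have h := tsum_reducedCount_mul_invCoprime r hj
  have h1 := ENNReal.hasSum_toReal (h.trans_ne ENNReal.ofReal_ne_top)
  have h2 : 0 ≤ eulerConst r j := by
    refine ge_of_tendsto' ((multipliable_zetaFactor r).mul
      (multipliable_localFactor_add_two r j)).hasProd.tendsto_prod_nat fun M =>
        Finset.prod_nonneg fun i _ => ?_
    rw [zetaFactor_mul_localFactor]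
    exact pow_nonneg (zero_le_one.trans (one_le_zetaAway hj (by omega))) _
  rw [← ENNReal.tsum_toReal_eq (fun a => ENNReal.ne_top_of_tsum_ne_top
    (h.trans_ne ENNReal.ofReal_ne_top) a), h, ENNReal.toReal_ofReal h2] at h1
  convert h1 using 2 with d
  rw [ENNReal.toReal_mul, ENNReal.toReal_natCast]
  change _ = _ * (if d.Coprime j then (d : ℝ≥0∞)⁻¹ else 0).toReal
  split_ifs with hd
  · rw [ENNReal.toReal_inv, ENNReal.toReal_natCast, div_eq_mul_inv]
  · simp

theorem reducedCount_zero (r : ℕ∞) : reducedCount r 0 = 0 := by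
  have : IsEmpty (ReducedArrays r 0) := ⟨fun g => cellNorm_ne_zero g.1 g.2.2⟩
  exact Nat.card_of_isEmpty

theorem minExp_one {r : ℕ∞} (hr : 1 ≤ r) : minExp 1 r = 1 := by
  rw [minExp, Nat.cast_one, min_eq_left hr]
  rfl

/-- The local factor at `m = 1` is `φ(j) / j`, which cancels the totient. -/
theorem cConst_eq {r : ℕ∞} (hr : 1 ≤ r) {j : ℕ} (hj : j ≠ 0) :
    cConst r j / j.totient = eulerConst r j / j := by
  have h1 : localFactor r j 1 = j.totient / j := by
    rw [localFactor, minExp_one hr]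
    have := Nat.totient_eq_mul_prod_factors j
    have h2 : (j.totient : ℝ) = j * ∏ p ∈ j.primeFactors, (1 - (p : ℝ)⁻¹) := by
      have h3 := congrArg (fun x : ℚ => (x : ℝ)) this
      push_cast at h3
      exact h3
    rw [h2, mul_div_cancel_left₀ _ (by exact_mod_cast hj)]
    simp
  have h2 : (j.totient : ℝ) ≠ 0 := by
    exact_mod_cast (Nat.totient_pos.2 (Nat.pos_of_ne_zero hj)).ne'
  have h3 : ∏' i : ℕ, localFactor r j (i + 1) =
      localFactor r j 1 * ∏' i : ℕ, localFactor r j (i + 2) := by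
    have h4 := tprod_eq_zero_mul' (f := fun i => localFactor r j (i + 1)) (by
      simpa only [add_assoc, one_add_one_eq_two] using multipliable_localFactor_add_two r j)
    simpa only [add_assoc, one_add_one_eq_two, zero_add] using h4
  rw [cConst, h3, eulerConst,
    (multipliable_zetaFactor r).tprod_mul (multipliable_localFactor_add_two r j), h1]
  field_simp

theorem cConst_pos (r : ℕ∞) (j : ℕ) : 0 < cConst r j := by
  rw [cConst, ← Real.rexp_tsum_eq_tprod (localFactor_pos r j) (summable_log_localFactor r j),
    ← Real.rexp_tsum_eq_tprod (fun i => lt_of_lt_of_le one_pos (one_le_zetaFactor r (by omega)))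
      (summable_log_zetaFactor r)]
  positivity

/-! ### Counting in residue classes and the mean value -/

/-- The number of positive `m ≤ X / d` with `d * m ≡ k` modulo `j`. -/
def residueCount (j k d X : ℕ) : ℕ := ((Finset.Icc 1 (X / d)).filter fun m => d * m ≡ k [MOD j]).card

theorem card_filter_dvd_eq_residueCount (j k X : ℕ) {d : ℕ} (hd : 0 < d) :
    ((Finset.Icc 1 X).filter fun n => n ≡ k [MOD j] ∧ d ∣ n).card = residueCount j k d X := by
  symm
  refine Finset.card_nbij' (fun m => d * m) (fun n => n / d) ?_ ?_ ?_ ?_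
  · intro m hm
    simp only [Finset.coe_filter, Finset.mem_Icc, Set.mem_ofPred_eq] at hm ⊢
    refine ⟨⟨Nat.mul_pos hd hm.1.1, ?_⟩, hm.2, dvd_mul_right _ _⟩
    rw [mul_comm]
    exact (Nat.le_div_iff_mul_le hd).1 hm.1.2
  · intro n hn
    simp only [Finset.coe_filter, Finset.mem_Icc, Set.mem_ofPred_eq] at hn ⊢
    refine ⟨⟨Nat.div_pos (Nat.le_of_dvd hn.1.1 hn.2.2) hd, Nat.div_le_div_right hn.1.2⟩, ?_⟩
    rw [Nat.mul_div_cancel' hn.2.2]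
    exact hn.2.1
  · intro m _
    exact Nat.mul_div_cancel_left m hd
  · intro n hn
    simp only [Finset.coe_filter, Finset.mem_Icc, Set.mem_ofPred_eq] at hn
    exact Nat.mul_div_cancel' hn.2.2

theorem sum_groupPartitionCount_eq {r : ℕ∞} (hr : 1 ≤ r) (j k X : ℕ) :
    ∑ n ∈ Finset.Icc 1 X with n ≡ k [MOD j], groupPartitionCount r n =
      ∑ d ∈ Finset.Icc 1 X, reducedCount r d * residueCount j k d X := by
  have h1 : ∀ n ∈ (Finset.Icc 1 X).filter fun n => n ≡ k [MOD j], groupPartitionCount r n =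
      ∑ d ∈ Finset.Icc 1 X, if d ∣ n then reducedCount r d else 0 := by
    intro n hn
    have hn := Finset.mem_Icc.1 (Finset.mem_filter.1 hn).1
    rw [groupPartitionCount_eq_sum_divisors hr (by omega), ← Finset.sum_filter]
    refine Finset.sum_congr ?_ fun _ _ => rfl
    ext d
    simp only [Nat.mem_divisors, Finset.mem_filter, Finset.mem_Icc]
    constructor
    · rintro ⟨h, h'⟩
      exact ⟨⟨Nat.pos_of_dvd_of_pos h (by omega), (Nat.le_of_dvd (by omega) h).trans hn.2⟩, h⟩
    · rintro ⟨-, h⟩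
      exact ⟨h, by omega⟩
  rw [Finset.sum_congr rfl h1, Finset.sum_comm]
  refine Finset.sum_congr rfl fun d hd => ?_
  rw [← Finset.sum_filter, Finset.sum_const, Finset.filter_filter,
    card_filter_dvd_eq_residueCount j k X (Finset.mem_Icc.1 hd).1, smul_eq_mul, mul_comm]

/-- A solution of `d * m ≡ k` forces `gcd(d, j)` to divide both `j` and `k`. -/
theorem residueCount_eq_zero {j k : ℕ} (hjk : Nat.Coprime j k) {d : ℕ} (hd : ¬ d.Coprime j)
    (X : ℕ) : residueCount j k d X = 0 := by
  rw [residueCount, Finset.card_eq_zero, Finset.filter_eq_empty_iff]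
  intro m _ h
  have h1 : d.gcd j ∣ k := (h.dvd_iff (Nat.gcd_dvd_right d j)).1
    ((Nat.gcd_dvd_left d j).trans (dvd_mul_right _ _))
  exact hd (Nat.eq_one_of_dvd_coprimes hjk (Nat.gcd_dvd_right d j) h1)

theorem residueCount_le (j k d X : ℕ) : residueCount j k d X ≤ X / d :=
  (Finset.card_filter_le _ _).trans (by simp)

/-- Multiplying by the inverse of `d` modulo `j` turns the condition into a single residue class. An
error of `1` comes from counting that class by floors, another from replacing `⌊X / d⌋` by `X / d`.
-/
theorem abs_residueCount_sub_le {j : ℕ} (hj : 0 < j) (k : ℕ) {d : ℕ} (hd : 0 < d)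
    (hdj : d.Coprime j) (X : ℕ) :
    |(residueCount j k d X : ℝ) - X / (d * j)| ≤ 2 := by
  have : NeZero j := ⟨hj.ne'⟩
  have hunit : IsUnit (d : ZMod j) := (ZMod.isUnit_iff_coprime d j).2 hdj
  let v : ℕ := ((d : ZMod j)⁻¹ * k).val
  have hv : ∀ m : ℕ, d * m ≡ k [MOD j] ↔ m ≡ v [MOD j] := by
    intro m
    rw [← ZMod.natCast_eq_natCast_iff, ← ZMod.natCast_eq_natCast_iff, ZMod.natCast_zmod_val,
      Nat.cast_mul]
    constructor
    · intro h
      rw [← h, ← mul_assoc, ZMod.inv_mul_of_unit _ hunit, one_mul]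
    · intro h
      rw [h, ← mul_assoc, ZMod.mul_inv_of_unit _ hunit, one_mul]
  have hcard : (residueCount j k d X : ℤ) =
      max (⌊(((X / d : ℕ) : ℚ) - v) / j⌋ - ⌊(((0 : ℕ) : ℚ) - v) / j⌋) 0 := by
    rw [← Nat.Ioc_filter_modEq_card 0 (X / d) hj v, residueCount]
    simp only [hv]
    rfl
  set Y := X / d with hY
  have hj' : (0 : ℚ) < j := by exact_mod_cast hj
  have hd' : (0 : ℝ) < d := by exact_mod_cast hd
  have hjR : (1 : ℝ) ≤ j := by exact_mod_cast hj
  have hq : |(residueCount j k d X : ℚ) - Y / j| ≤ 1 := by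
    have e1 := Int.floor_le (((Y : ℚ) - v) / j)
    have e2 := Int.lt_floor_add_one (((Y : ℚ) - v) / j)
    have e3 := Int.floor_le ((((0 : ℕ) : ℚ) - v) / j)
    have e4 := Int.lt_floor_add_one ((((0 : ℕ) : ℚ) - v) / j)
    have e5 : ((Y : ℚ) - v) / j - (((0 : ℕ) : ℚ) - v) / j = Y / j := by
      rw [← sub_div]
      simp
    have e6 : (0 : ℚ) ≤ Y / j := by positivity
    have hcast : (residueCount j k d X : ℚ) =
        max ((⌊((Y : ℚ) - v) / j⌋ : ℚ) - ⌊(((0 : ℕ) : ℚ) - v) / j⌋) 0 := by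
      exact_mod_cast congrArg (fun z : ℤ => (z : ℚ)) hcard
    rw [hcast, abs_le]
    constructor
    · have := le_max_left ((⌊((Y : ℚ) - v) / j⌋ : ℚ) - ⌊(((0 : ℕ) : ℚ) - v) / j⌋) 0
      linarith
    · have : max ((⌊((Y : ℚ) - v) / j⌋ : ℚ) - ⌊(((0 : ℕ) : ℚ) - v) / j⌋) 0 ≤ Y / j + 1 :=
        max_le (by linarith) (by linarith)
      linarith
  have hR : |(residueCount j k d X : ℝ) - Y / j| ≤ 1 := by
    have h : ((|(residueCount j k d X : ℚ) - Y / j| : ℚ) : ℝ) ≤ ((1 : ℚ) : ℝ) := by exact_mod_cast hq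
    push_cast at h
    exact h
  have hY1 : (Y : ℝ) ≤ X / d := Nat.cast_div_le
  have hY2 : (X : ℝ) / d ≤ Y + 1 := by
    rw [div_le_iff₀ hd']
    have := (Nat.lt_mul_div_succ X hd).le
    calc (X : ℝ) ≤ ((d * (X / d + 1) : ℕ) : ℝ) := by exact_mod_cast this
      _ = (Y + 1) * d := by push_cast; ring
  have h3 : |(Y : ℝ) / j - X / (d * j)| ≤ 1 := by
    rw [← div_div, ← sub_div, abs_div, abs_of_pos (by linarith : (0 : ℝ) < j),
      div_le_one (by linarith), abs_le]
    constructor <;> linarith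
  calc |(residueCount j k d X : ℝ) - X / (d * j)|
      ≤ |(residueCount j k d X : ℝ) - Y / j| + |(Y : ℝ) / j - X / (d * j)| := abs_sub_le _ _ _
    _ ≤ 2 := by linarith

theorem tendsto_residueCount_div {j : ℕ} (hj : 0 < j) (k : ℕ) {d : ℕ} (hd : 0 < d)
    (hdj : d.Coprime j) :
    Tendsto (fun X : ℕ => (residueCount j k d X : ℝ) / X) atTop (nhds (1 / (d * j))) := by
  rw [tendsto_iff_norm_sub_tendsto_zero]
  refine squeeze_zero' (Eventually.of_forall fun X => norm_nonneg _) ?_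
    (tendsto_const_div_atTop_nhds_zero_nat 2)
  filter_upwards [eventually_gt_atTop 0] with X hX
  have hX' : (0 : ℝ) < X := by exact_mod_cast hX
  have h : (residueCount j k d X : ℝ) / X - 1 / (d * j) =
      ((residueCount j k d X : ℝ) - X / (d * j)) / X := by
    field_simp
  rw [h, Real.norm_eq_abs, abs_div, abs_of_pos hX']
  gcongr
  exact abs_residueCount_sub_le hj k hd hdj X

theorem tendsto_sum_groupPartitionCount_div {r : ℕ∞} (hr : 1 ≤ r) {j k : ℕ} (hj : 0 < j)
    (hjk : Nat.Coprime j k) :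
    Tendsto (fun X : ℕ =>
      (∑ n ∈ Finset.Icc 1 X with n ≡ k [MOD j], (groupPartitionCount r n : ℝ)) / X) atTop
      (nhds (cConst r j / j.totient)) := by
  have hsum := hasSum_reducedCount_div r hj.ne'
  rw [cConst_eq hr hj.ne', ← (hsum.div_const (j : ℝ)).tsum_eq]
  have h1 : ∀ X : ℕ,
      (∑ n ∈ Finset.Icc 1 X with n ≡ k [MOD j], (groupPartitionCount r n : ℝ)) / X =
        ∑' d, (reducedCount r d : ℝ) * ((residueCount j k d X : ℝ) / X) := by
    intro X
    rw [tsum_eq_sum (s := Finset.Icc 1 X) fun d hd => ?_]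
    · have h := sum_groupPartitionCount_eq hr j k X
      have h' := congrArg (fun m : ℕ => (m : ℝ)) h
      push_cast at h'
      rw [h', Finset.sum_div]
      exact Finset.sum_congr rfl fun d _ => mul_div_assoc _ _ _
    · rcases Nat.eq_zero_or_pos d with rfl | hd0
      · simp [reducedCount_zero]
      · have hXd : X < d := by
          by_contra h
          exact hd (Finset.mem_Icc.2 ⟨hd0, not_lt.1 h⟩)
        have h2 := residueCount_le j k d X
        rw [Nat.div_eq_of_lt hXd] at h2
        simp [Nat.le_zero.1 h2]
  simp only [h1]
  -- The majorant is `reducedCount r d / d` on `d` prime to `j`, because `residueCount` is at most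
  -- `X / d`.
  refine tendsto_tsum_of_dominated_convergence hsum.summable (fun d => ?_)
    (Eventually.of_forall fun X d => ?_)
  · rcases Nat.eq_zero_or_pos d with rfl | hd0
    · simp [reducedCount_zero]
    · split_ifs with hd
      · have := (tendsto_residueCount_div hj k hd0 hd).const_mul (reducedCount r d : ℝ)
        rwa [mul_one_div, ← div_div] at this
      · simp [residueCount_eq_zero hjk hd]
  · split_ifs with hd
    · rw [Real.norm_of_nonneg (by positivity), div_eq_mul_inv (reducedCount r d : ℝ)]
      refine mul_le_mul_of_nonneg_left ?_ (Nat.cast_nonneg _)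
      rcases Nat.eq_zero_or_pos X with rfl | hX
      · simp
      · rw [div_le_iff₀ (by exact_mod_cast hX), inv_mul_eq_div]
        exact (Nat.cast_le.2 (residueCount_le j k d X)).trans Nat.cast_div_le
    · simp [residueCount_eq_zero hjk hd]

/-- Passes from integers to real `x` by `⌊x⌋₊ / x → 1`. -/
theorem isLittleO_of_tendsto_div_nat {S : ℕ → ℝ} {C : ℝ}
    (h : Tendsto (fun X : ℕ => S X / X) atTop (nhds C)) :
    (fun x : ℝ => S ⌊x⌋₊ - C * x) =o[atTop] fun x : ℝ => x := by
  refine isLittleO_of_tendsto' ?_ ?_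
  · filter_upwards [eventually_gt_atTop 0] with x hx hx'
    exact (hx.ne' hx').elim
  · have h1 : Tendsto (fun x : ℝ => S ⌊x⌋₊ / (⌊x⌋₊ : ℝ) * ((⌊x⌋₊ : ℝ) / x) - C) atTop
        (nhds (C * 1 - C)) :=
      ((h.comp tendsto_nat_floor_atTop).mul tendsto_nat_floor_div_atTop).sub_const C
    rw [mul_one, sub_self] at h1
    refine h1.congr' ?_
    filter_upwards [eventually_ge_atTop 1] with x hx
    have h2 : (⌊x⌋₊ : ℝ) ≠ 0 := by
      exact_mod_cast (Nat.floor_pos.2 hx).ne'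
    have h3 : x ≠ 0 := by linarith
    field_simp

theorem cConst_one (r : ℕ∞) : cConst r 1 = ∏' i : ℕ, zetaFactor r (i + 2) := by
  simp [cConst, localFactor]

theorem theorem4p3 (r : ℕ∞) (hr : 1 ≤ r) :
    (Multipliable (fun i : ℕ => zetaFactor r (i + 2)) ∧
      (fun x : ℝ => (∑ n ∈ Finset.Icc 1 ⌊x⌋₊, (groupPartitionCount r n : ℝ)) -
        (∏' i : ℕ, zetaFactor r (i + 2)) * x) =o[atTop] (fun x : ℝ => x)) ∧
    ∀ j k : ℕ, 0 < j → 0 < k → Nat.Coprime j k →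
      Multipliable (fun i : ℕ => localFactor r j (i + 1)) ∧
      0 < cConst r j ∧
      (fun x : ℝ => (∑ n ∈ Finset.Icc 1 ⌊x⌋₊ with n ≡ k [MOD j], (groupPartitionCount r n : ℝ)) -
        cConst r j / (Nat.totient j : ℝ) * x) =o[atTop] (fun x : ℝ => x) := by
  refine ⟨⟨multipliable_zetaFactor r, ?_⟩, fun j k hj _ hjk => ⟨multipliable_localFactor r j,
    cConst_pos r j, isLittleO_of_tendsto_div_nat (tendsto_sum_groupPartitionCount_div hr hj hjk)⟩⟩
  -- The unrestricted sum is the case `j = k = 1`, where the congruence is vacuous.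
  have h := isLittleO_of_tendsto_div_nat
    (tendsto_sum_groupPartitionCount_div hr one_pos (Nat.coprime_one_left 1))
  rw [cConst_one, Nat.totient_one, Nat.cast_one, div_one] at h
  refine h.congr_left fun x => ?_
  rw [Finset.filter_true_of_mem fun n _ => Nat.modEq_one]
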